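/- Let $\Upsilon_1=\langle\alpha\rangle$ be the free monoid of rank $1$. Let $A_2(\Upsilon_1)$ be the ring representing degree $2$ representations $\rho:\Upsilon_1\to \mathrm{M}_2(\Gamma(T,\mathcal O_T))$ on schemes $T$, let $\mathrm{Rep}_2(\Upsilon_1)=\mathrm{Spec}\,A_2(\Upsilon_1)$, and let $\sigma$ be the universal representation. Let $\mathrm{Rep}_2(\Upsilon_1)_{\mathrm{rk}\le 2}$ be the closed subscheme where all $3\times 3$ minors of the $4\times 3$ matrices formed by the entries of $\sigma(\beta_1),\sigma(\beta_2),\sigma(\beta_3)$ ($\beta_i\in\Upsilon_1$) vanish, and let $\mathrm{Rep}_2(\Upsilon_1)_{\mathrm{rk}2}$ be its open subscheme of representations $\rho$ for which $\mathcal O[\rho(\Upsilon_1)]\subseteq \mathrm{M}_2(\mathcal O)$ is a rank $2$ mold, i.e. is a subalgebra of rank $2$ with $\mathrm{M}_2(\mathcal O)/\mathcal O[\rho(\Upsilon_1)]$ locally free. Let $\mathrm{Ch}_2(\Upsilon_1)=\mathrm{Spec}\,A_2(\Upsilon_1)^{\mathrm{Ch}}$, where $A_2(\Upsilon_1)^{\mathrm{Ch}}\subseteq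 A_2(\Upsilon_1)$ is the subring generated by all $\mathrm{tr}\,\sigma(\gamma)$ and $\det\sigma(\gamma)$, $\gamma\in\Upsilon_1$. Let the group scheme $\mathrm{PGL}_2=\underline{\mathrm{Aut}}(\mathrm{M}_2)$ over $\mathbb Z$ act on $\mathrm{Rep}_2(\Upsilon_1)$ by conjugation. Then $\mathbb Z[T,D]\to A_2(\Upsilon_1)^{\mathrm{Ch}}$, $T\mapsto \mathrm{tr}\,\sigma(\alpha)$, $D\mapsto\det\sigma(\alpha)$, is an isomorphism, the action of $\mathrm{PGL}_2$ restricts to $\mathrm{Rep}_2(\Upsilon_1)_{\mathrm{rk}2}$, and the canonical morphism $$\pi:\mathrm{Rep}_2(\Upsilon_1)_{\mathrm{rk}2}\to \mathrm{Ch}_2(\Upsilon_1)\cong\mathrm{Spec}\,\mathbb Z[T,D],\qquad A=\rho(\alpha)\mapsto(\mathrm{tr}\,A,\det A),$$ is a universal geometric quotient by $\mathrm{PGL}_2$: for every morphism of schemes $Y'\to \mathrm{Ch}_2(\Upsilon_1)$, the base change $\pi':X'=\mathrm{Rep}_2(\Upsilon_1)_{\mathrm{rk}2}\times_{\mathrm{Ch}_2(\Upsilon_1)}Y'\to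 Y'$ with the induced action $\sigma':\mathrm{PGL}_2\times X'\to X'$ satisfies: (i) $\pi'\circ\sigma'=\pi'\circ p_2$; (ii) $\pi'$ is surjective and the image of $(\sigma',p_2):\mathrm{PGL}_2\times X'\to X'\times X'$ is $X'\times_{Y'}X'$; (iii) $\pi'$ is submersive, i.e. $U\subseteq Y'$ is open if and only if $\pi'^{-1}(U)$ is; (iv) $\mathcal O_{Y'}$ is the subsheaf of $\mathrm{PGL}_2$-invariant functions in $\pi'_*\mathcal O_{X'}$. -/

import Mathlib

open CategoryTheory MonoidalCategory CartesianMonoidalCategory Limits AlgebraicGeometry Opposite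

noncomputable section

namespace MatTwo

/-- The `R`-linear endomorphism of `M₂(R)` that sends the matrix unit `E i j` to `F i j`. -/
def unitLin {R : Type*} [CommRing R] (F : Fin 2 → Fin 2 → Matrix (Fin 2) (Fin 2) R) :
    Matrix (Fin 2) (Fin 2) R →ₗ[R] Matrix (Fin 2) (Fin 2) R where
  toFun X := ∑ i, ∑ j, X i j • F i j
  map_add' X Y := by simp [add_smul, Finset.sum_add_distrib]
  map_smul' c X := by simp [mul_smul]

theorem unitLin_apply {R : Type*} [CommRing R] (F : Fin 2 → Fin 2 → Matrix (Fin 2) (Fin 2) R)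
    (X : Matrix (Fin 2) (Fin 2) R) : unitLin F X = ∑ i, ∑ j, X i j • F i j := rfl

theorem unitLin_single {R : Type*} [CommRing R] (F : Fin 2 → Fin 2 → Matrix (Fin 2) (Fin 2) R)
    (i j : Fin 2) : unitLin F (Matrix.single i j 1) = F i j := by
  rw [unitLin_apply]
  fin_cases i <;> fin_cases j <;> simp [Fin.sum_univ_two]

/-- If the matrices `F i j` multiply like the matrix units, then `unitLin F` is an algebra
endomorphism. -/
def ofUnits {R : Type*} [CommRing R] (F : Fin 2 → Fin 2 → Matrix (Fin 2) (Fin 2) R)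
    (h1 : ∑ i, F i i = 1)
    (hmul : ∀ i j k l, F i j * F k l = if j = k then F i l else 0) :
    Matrix (Fin 2) (Fin 2) R →ₐ[R] Matrix (Fin 2) (Fin 2) R :=
  AlgHom.ofLinearMap (unitLin F)
    (by
      refine Eq.trans ?_ h1
      rw [unitLin_apply]
      simp [Fin.sum_univ_two])
    (fun X Y => by
      simp only [unitLin_apply, Fin.sum_univ_two, Matrix.mul_apply, add_mul,
        mul_add, smul_mul_smul_comm, hmul]
      simp only [if_true, Fin.isValue, zero_ne_one, one_ne_zero, if_false, smul_zero]
      module)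

theorem ofUnits_single {R : Type*} [CommRing R] (F : Fin 2 → Fin 2 → Matrix (Fin 2) (Fin 2) R)
    (h1 : ∑ i, F i i = 1)
    (hmul : ∀ i j k l, F i j * F k l = if j = k then F i l else 0) (i j : Fin 2) :
    ofUnits F h1 hmul (Matrix.single i j 1) = F i j :=
  unitLin_single F i j

theorem algHom_ext {R : Type*} [CommRing R]
    {φ ψ : Matrix (Fin 2) (Fin 2) R →ₐ[R] Matrix (Fin 2) (Fin 2) R}
    (h : ∀ i j, φ (Matrix.single i j 1) = ψ (Matrix.single i j 1)) : φ = ψ := by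
  ext1 X
  rw [Matrix.matrix_eq_sum_single X]
  simp only [map_sum]
  refine Finset.sum_congr rfl fun i _ => Finset.sum_congr rfl fun j _ => ?_
  have : Matrix.single i j (X i j) = X i j • Matrix.single i j (1 : R) := by simp
  rw [this, map_smul, map_smul, h]

theorem units_mul {R : Type*} [CommRing R] (i j k l : Fin 2) :
    (Matrix.single i j (1 : R)) * Matrix.single k l 1 =
      if j = k then Matrix.single i l 1 else 0 := by
  split_ifs with h
  · subst h; simp
  · exact Matrix.single_mul_single_of_ne _ _ _ _ h _

theorem sum_units {R : Type*} [CommRing R] :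
    ∑ i : Fin 2, Matrix.single i i (1 : R) = 1 := by
  ext i j; fin_cases i <;> fin_cases j <;> simp [Fin.sum_univ_two]

/-- Base change along `f : R → S` of an algebra endomorphism of `M₂(R)`. -/
def baseChangeHom {R S : Type*} [CommRing R] [CommRing S] (f : R →+* S)
    (φ : Matrix (Fin 2) (Fin 2) R →ₐ[R] Matrix (Fin 2) (Fin 2) R) :
    Matrix (Fin 2) (Fin 2) S →ₐ[S] Matrix (Fin 2) (Fin 2) S :=
  ofUnits (fun i j => f.mapMatrix (φ (Matrix.single i j 1)))
    (by rw [← map_sum, ← map_sum, sum_units, map_one, map_one])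
    (fun i j k l => by rw [← map_mul, ← map_mul, units_mul]; split_ifs <;> simp)

theorem baseChangeHom_mapMatrix {R S : Type*} [CommRing R] [CommRing S] (f : R →+* S)
    (φ : Matrix (Fin 2) (Fin 2) R →ₐ[R] Matrix (Fin 2) (Fin 2) R)
    (X : Matrix (Fin 2) (Fin 2) R) :
    baseChangeHom f φ (f.mapMatrix X) = f.mapMatrix (φ X) := by
  conv_rhs => rw [Matrix.matrix_eq_sum_single X]
  simp only [map_sum]
  change ∑ i, ∑ j, f (X i j) • f.mapMatrix (φ (Matrix.single i j 1)) = _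
  refine Finset.sum_congr rfl fun i _ => Finset.sum_congr rfl fun j _ => ?_
  have : Matrix.single i j (X i j) = X i j • Matrix.single i j (1 : R) := by simp
  rw [this, map_smul]
  ext s t
  simp

theorem baseChangeHom_single {R S : Type*} [CommRing R] [CommRing S] (f : R →+* S)
    (φ : Matrix (Fin 2) (Fin 2) R →ₐ[R] Matrix (Fin 2) (Fin 2) R) (i j : Fin 2) :
    baseChangeHom f φ (Matrix.single i j 1) = f.mapMatrix (φ (Matrix.single i j 1)) :=
  ofUnits_single _ _ _ _ _

theorem mapMatrix_single {R S : Type*} [CommRing R] [CommRing S] (f : R →+* S) (i j : Fin 2) :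
    f.mapMatrix (Matrix.single i j 1) = Matrix.single i j 1 := by
  simp

theorem baseChangeHom_id {R S : Type*} [CommRing R] [CommRing S] (f : R →+* S) :
    baseChangeHom f (AlgHom.id R (Matrix (Fin 2) (Fin 2) R)) = AlgHom.id S _ :=
  algHom_ext fun i j => by
    rw [baseChangeHom_single, AlgHom.id_apply, AlgHom.id_apply, mapMatrix_single]

theorem baseChangeHom_comp {R S : Type*} [CommRing R] [CommRing S] (f : R →+* S)
    (φ ψ : Matrix (Fin 2) (Fin 2) R →ₐ[R] Matrix (Fin 2) (Fin 2) R) :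
    baseChangeHom f (φ.comp ψ) = (baseChangeHom f φ).comp (baseChangeHom f ψ) :=
  algHom_ext fun i j => by
    rw [baseChangeHom_single, AlgHom.comp_apply, AlgHom.comp_apply, baseChangeHom_single,
      baseChangeHom_mapMatrix]

/-- Base change along `f : R → S` of algebra automorphisms of the matrix algebra, as a
homomorphism `Aut(M₂(R)) → Aut(M₂(S))`. -/
def autMap {R S : Type*} [CommRing R] [CommRing S] (f : R →+* S) :
    (Matrix (Fin 2) (Fin 2) R ≃ₐ[R] Matrix (Fin 2) (Fin 2) R) →*
      (Matrix (Fin 2) (Fin 2) S ≃ₐ[S] Matrix (Fin 2) (Fin 2) S) where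
  toFun φ := AlgEquiv.ofAlgHom (baseChangeHom f φ) (baseChangeHom f φ.symm)
    (by rw [← baseChangeHom_comp, AlgEquiv.comp_symm, baseChangeHom_id])
    (by rw [← baseChangeHom_comp, AlgEquiv.symm_comp, baseChangeHom_id])
  map_one' := AlgEquiv.coe_toAlgHom_injective (baseChangeHom_id f)
  map_mul' φ ψ := AlgEquiv.coe_toAlgHom_injective (baseChangeHom_comp f φ.toAlgHom ψ.toAlgHom)

theorem autMap_mapMatrix {R S : Type*} [CommRing R] [CommRing S] (f : R →+* S)
    (φ : Matrix (Fin 2) (Fin 2) R ≃ₐ[R] Matrix (Fin 2) (Fin 2) R)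
    (X : Matrix (Fin 2) (Fin 2) R) :
    autMap f φ (f.mapMatrix X) = f.mapMatrix (φ X) :=
  baseChangeHom_mapMatrix f φ.toAlgHom X

theorem autMap_single {R S : Type*} [CommRing R] [CommRing S] (f : R →+* S)
    (φ : Matrix (Fin 2) (Fin 2) R ≃ₐ[R] Matrix (Fin 2) (Fin 2) R) (i j : Fin 2) :
    autMap f φ (Matrix.single i j 1) = f.mapMatrix (φ (Matrix.single i j 1)) :=
  baseChangeHom_single f φ.toAlgHom i j

theorem aut_ext {R : Type*} [CommRing R]
    {φ ψ : Matrix (Fin 2) (Fin 2) R ≃ₐ[R] Matrix (Fin 2) (Fin 2) R}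
    (h : ∀ i j, φ (Matrix.single i j 1) = ψ (Matrix.single i j 1)) : φ = ψ :=
  AlgEquiv.coe_toAlgHom_injective (algHom_ext h)

theorem autMap_id {R : Type*} [CommRing R]
    (φ : Matrix (Fin 2) (Fin 2) R ≃ₐ[R] Matrix (Fin 2) (Fin 2) R) :
    autMap (RingHom.id R) φ = φ :=
  aut_ext fun i j => by rw [autMap_single]; simp

theorem autMap_comp {R S T : Type*} [CommRing R] [CommRing S] [CommRing T] (f : R →+* S)
    (g : S →+* T) (φ : Matrix (Fin 2) (Fin 2) R ≃ₐ[R] Matrix (Fin 2) (Fin 2) R) :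
    autMap (g.comp f) φ = autMap g (autMap f φ) :=
  aut_ext fun i j => by
    rw [autMap_single, autMap_single, autMap_single]
    ext s t
    simp

/-! ### The coordinate ring of `PGL₂` -/

/-- The polynomial ring in the entries `x i j k l` of the images `φ (E i j)` of the matrix units
and the entries `y i j k l` of their preimages `φ⁻¹ (E i j)`. -/
abbrev AutPoly : Type :=
  MvPolynomial ((Fin 2 × Fin 2 × Fin 2 × Fin 2) ⊕ (Fin 2 × Fin 2 × Fin 2 × Fin 2)) ℤ

def genF (i j : Fin 2) : Matrix (Fin 2) (Fin 2) AutPoly :=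
  Matrix.of fun k l => MvPolynomial.X (Sum.inl (i, j, k, l))

def genG (i j : Fin 2) : Matrix (Fin 2) (Fin 2) AutPoly :=
  Matrix.of fun k l => MvPolynomial.X (Sum.inr (i, j, k, l))

/-- The entries of the matrices in this set are the equations saying that `x` is unital and
multiplicative, and that `x` and `y` are inverse to each other. -/
def autRelMatrices : Set (Matrix (Fin 2) (Fin 2) AutPoly) :=
  {∑ i, genF i i - 1} ∪
  {N | ∃ i j k l, N = genF i j * genF k l - if j = k then genF i l else 0} ∪
  {N | ∃ i j, N = ∑ s, ∑ t, genF i j s t • genG s t - Matrix.single i j 1} ∪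
  {N | ∃ i j, N = ∑ s, ∑ t, genG i j s t • genF s t - Matrix.single i j 1}

def autIdeal : Ideal AutPoly :=
  Ideal.span {p | ∃ N ∈ autRelMatrices, ∃ s t, p = N s t}

/-- The coordinate ring of the scheme of algebra automorphisms of the `2 × 2` matrix algebra. -/
abbrev AutRing : Type := AutPoly ⧸ autIdeal

theorem autRel_zero {N : Matrix (Fin 2) (Fin 2) AutPoly} (hN : N ∈ autRelMatrices) :
    (Ideal.Quotient.mk autIdeal).mapMatrix N = 0 := by
  ext s t
  exact Ideal.Quotient.eq_zero_iff_mem.mpr (Ideal.subset_span ⟨N, hN, s, t, rfl⟩)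

def univF (i j : Fin 2) : Matrix (Fin 2) (Fin 2) AutRing :=
  (Ideal.Quotient.mk autIdeal).mapMatrix (genF i j)

def univG (i j : Fin 2) : Matrix (Fin 2) (Fin 2) AutRing :=
  (Ideal.Quotient.mk autIdeal).mapMatrix (genG i j)

theorem mapMatrix_smul' {R S : Type*} [CommRing R] [CommRing S] (f : R →+* S) (c : R)
    (X : Matrix (Fin 2) (Fin 2) R) : f.mapMatrix (c • X) = f c • f.mapMatrix X := by
  ext s t; simp

theorem univF_one : ∑ i, univF i i = 1 := by
  have := autRel_zero (N := ∑ i, genF i i - 1) (by simp [autRelMatrices])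
  rw [map_sub, map_sum, map_one, sub_eq_zero] at this
  exact this

theorem univF_mul (i j k l : Fin 2) :
    univF i j * univF k l = if j = k then univF i l else 0 := by
  have := autRel_zero (N := genF i j * genF k l - if j = k then genF i l else 0)
    (Or.inl (Or.inl (Or.inr ⟨i, j, k, l, rfl⟩)))
  rw [map_sub, map_mul, sub_eq_zero] at this
  rw [univF, univF, this]
  split_ifs <;> simp [univF]

theorem univFG (i j : Fin 2) :
    ∑ s, ∑ t, univF i j s t • univG s t = Matrix.single i j 1 := by
  have := autRel_zero (N := ∑ s, ∑ t, genF i j s t • genG s t - Matrix.single i j 1)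
    (Or.inl (Or.inr ⟨i, j, rfl⟩))
  rw [map_sub, sub_eq_zero, mapMatrix_single] at this
  simp only [map_sum, mapMatrix_smul'] at this
  exact this

theorem univGF (i j : Fin 2) :
    ∑ s, ∑ t, univG i j s t • univF s t = Matrix.single i j 1 := by
  have := autRel_zero (N := ∑ s, ∑ t, genG i j s t • genF s t - Matrix.single i j 1)
    (Or.inr ⟨i, j, rfl⟩)
  rw [map_sub, sub_eq_zero, mapMatrix_single] at this
  simp only [map_sum, mapMatrix_smul'] at this
  exact this

theorem unitLin_inv {R : Type*} [CommRing R] {F G : Fin 2 → Fin 2 → Matrix (Fin 2) (Fin 2) R}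
    (h : ∀ i j, ∑ s, ∑ t, F i j s t • G s t = Matrix.single i j 1)
    (X : Matrix (Fin 2) (Fin 2) R) : unitLin G (unitLin F X) = X := by
  rw [Matrix.matrix_eq_sum_single X]
  simp only [map_sum]
  refine Finset.sum_congr rfl fun i _ => Finset.sum_congr rfl fun j _ => ?_
  have : Matrix.single i j (X i j) = X i j • Matrix.single i j (1 : R) := by simp
  rw [this, map_smul, map_smul, unitLin_single]
  exact congrArg _ (h i j)

/-- The universal algebra automorphism of the `2 × 2` matrix algebra. -/
def univAut : Matrix (Fin 2) (Fin 2) AutRing ≃ₐ[AutRing] Matrix (Fin 2) (Fin 2) AutRing :=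
  { ofUnits univF univF_one univF_mul with
    invFun := unitLin univG
    left_inv := unitLin_inv univFG
    right_inv := unitLin_inv univGF }

theorem univAut_single (i j : Fin 2) : univAut (Matrix.single i j 1) = univF i j :=
  ofUnits_single _ univF_one univF_mul i j

theorem univAut_symm_single (i j : Fin 2) : univAut.symm (Matrix.single i j 1) = univG i j :=
  unitLin_single univG i j

theorem aut_sum {R : Type*} [CommRing R]
    (φ : Matrix (Fin 2) (Fin 2) R ≃ₐ[R] Matrix (Fin 2) (Fin 2) R)
    (X : Matrix (Fin 2) (Fin 2) R) :
    ∑ s, ∑ t, X s t • φ (Matrix.single s t 1) = φ X := by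
  conv_rhs => rw [Matrix.matrix_eq_sum_single X]
  simp only [map_sum]
  refine Finset.sum_congr rfl fun i _ => Finset.sum_congr rfl fun j _ => ?_
  rw [← map_smul]; simp

/-- The polynomial-ring point given by the coordinates of an automorphism and its inverse. -/
def autEval {R : Type*} [CommRing R]
    (φ : Matrix (Fin 2) (Fin 2) R ≃ₐ[R] Matrix (Fin 2) (Fin 2) R) : AutPoly →+* R :=
  (MvPolynomial.aeval (Sum.elim
    (fun p => φ (Matrix.single p.1 p.2.1 1) p.2.2.1 p.2.2.2)
    (fun p => φ.symm (Matrix.single p.1 p.2.1 1) p.2.2.1 p.2.2.2))).toRingHom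

theorem autEval_genF {R : Type*} [CommRing R]
    (φ : Matrix (Fin 2) (Fin 2) R ≃ₐ[R] Matrix (Fin 2) (Fin 2) R) (i j : Fin 2) :
    (autEval φ).mapMatrix (genF i j) = φ (Matrix.single i j 1) := by
  ext s t; simp [autEval, genF]

theorem autEval_genG {R : Type*} [CommRing R]
    (φ : Matrix (Fin 2) (Fin 2) R ≃ₐ[R] Matrix (Fin 2) (Fin 2) R) (i j : Fin 2) :
    (autEval φ).mapMatrix (genG i j) = φ.symm (Matrix.single i j 1) := by
  ext s t; simp [autEval, genG]

theorem autEval_rel {R : Type*} [CommRing R]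
    (φ : Matrix (Fin 2) (Fin 2) R ≃ₐ[R] Matrix (Fin 2) (Fin 2) R)
    {N : Matrix (Fin 2) (Fin 2) AutPoly} (hN : N ∈ autRelMatrices) :
    (autEval φ).mapMatrix N = 0 := by
  have hF : ∀ i j s t, autEval φ (genF i j s t) = φ (Matrix.single i j 1) s t := fun i j s t => by
    rw [← autEval_genF]; rfl
  have hG : ∀ i j s t, autEval φ (genG i j s t) = φ.symm (Matrix.single i j 1) s t :=
    fun i j s t => by rw [← autEval_genG]; rfl
  rcases hN with ((hN | ⟨i, j, k, l, rfl⟩) | ⟨i, j, rfl⟩) | ⟨i, j, rfl⟩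
  · rw [Set.mem_singleton_iff] at hN
    subst hN
    rw [map_sub, map_sum, map_one, sub_eq_zero]
    simp only [autEval_genF]
    rw [← map_sum, sum_units, map_one]
  · rw [map_sub, map_mul, autEval_genF, autEval_genF, ← map_mul, units_mul, sub_eq_zero]
    split_ifs
    · rw [autEval_genF]
    · simp
  · rw [map_sub, sub_eq_zero, mapMatrix_single]
    simp only [map_sum, mapMatrix_smul', autEval_genG, hF]
    rw [aut_sum, AlgEquiv.symm_apply_apply]
  · rw [map_sub, sub_eq_zero, mapMatrix_single]
    simp only [map_sum, mapMatrix_smul', autEval_genF, hG]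
    rw [aut_sum, AlgEquiv.apply_symm_apply]

/-- `AutRing` represents the functor of algebra automorphisms of the matrix algebra. -/
def autPoint {R : Type*} [CommRing R] :
    (AutRing →+* R) ≃ (Matrix (Fin 2) (Fin 2) R ≃ₐ[R] Matrix (Fin 2) (Fin 2) R) where
  toFun f := autMap f univAut
  invFun φ := Ideal.Quotient.lift autIdeal (autEval φ) (fun a ha => by
    have : autIdeal ≤ RingHom.ker (autEval φ) := by
      refine Ideal.span_le.mpr ?_
      rintro _ ⟨N, hN, s, t, rfl⟩
      exact congrFun (congrFun (autEval_rel φ hN) s) t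
    exact this ha)
  left_inv f := by
    refine Ideal.Quotient.ringHom_ext (MvPolynomial.ringHom_ext (fun n => by simp) ?_)
    have hsymm : (autMap f univAut).symm = autMap f univAut.symm := by
      change (autMap f univAut)⁻¹ = autMap f univAut⁻¹
      rw [map_inv]
    rintro (⟨i, j, k, l⟩ | ⟨i, j, k, l⟩)
    · simp [autEval, autMap_single, univAut_single, univF, genF]
    · simp [autEval, hsymm, autMap_single, univAut_symm_single, univG, genG]
  right_inv φ := aut_ext fun i j => by
    rw [autMap_single, univAut_single, ← autEval_genF]
    rfl

end MatTwo

/-! ### Points of affine schemes -/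

/-- Morphisms `T → Spec R` are ring homomorphisms from `R` to the global functions on `T`. -/
def specPoint (R : Type) [CommRing R] (T : Scheme.{0}) :
    (T ⟶ Spec (CommRingCat.of R)) ≃ (R →+* Γ(T, ⊤)) where
  toFun f := f.appTop.hom.comp (Scheme.ΓSpecIso (CommRingCat.of R)).inv.hom
  invFun φ := T.toSpecΓ ≫ Spec.map (CommRingCat.ofHom φ)
  left_inv f := by
    have : CommRingCat.ofHom (f.appTop.hom.comp (Scheme.ΓSpecIso (CommRingCat.of R)).inv.hom) =
        (Scheme.ΓSpecIso (CommRingCat.of R)).inv ≫ f.appTop := rfl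
    simp only [this, Spec.map_comp]
    rw [← Scheme.toSpecΓ_naturality_assoc, toSpecΓ_SpecMap_ΓSpecIso_inv, Category.comp_id]
  right_inv φ := by
    have h : (Scheme.ΓSpecIso (CommRingCat.of R)).inv ≫
        (T.toSpecΓ ≫ Spec.map (CommRingCat.ofHom φ)).appTop = CommRingCat.ofHom φ := by
      rw [Scheme.Hom.comp_appTop, Scheme.toSpecΓ_appTop, ← Scheme.ΓSpecIso_inv_naturality_assoc]
      simp
    exact congrArg CommRingCat.Hom.hom h

theorem specPoint_comp (R : Type) [CommRing R] {T T' : Scheme.{0}} (g : T' ⟶ T)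
    (f : T ⟶ Spec (CommRingCat.of R)) :
    specPoint R T' (g ≫ f) = g.appTop.hom.comp (specPoint R T f) := by
  simp only [specPoint, Equiv.coe_fn_mk, Scheme.Hom.comp_appTop]
  rfl

/-! ### The group scheme `PGL₂` -/

/-- The functor `T ↦ Aut(M₂(𝒪_T))` on schemes, with composition as the group law. -/
def autFunctor : Scheme.{0}ᵒᵖ ⥤ GrpCat.{0} where
  obj T := GrpCat.of (Matrix (Fin 2) (Fin 2) Γ(T.unop, ⊤) ≃ₐ[Γ(T.unop, ⊤)]
    Matrix (Fin 2) (Fin 2) Γ(T.unop, ⊤))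
  map f := GrpCat.ofHom (MatTwo.autMap f.unop.appTop.hom)
  map_id T := by
    ext φ : 2
    simp only [unop_id, Scheme.Hom.id_appTop]
    exact MatTwo.autMap_id φ
  map_comp f g := by
    ext φ : 2
    simp only [unop_comp, Scheme.Hom.comp_appTop]
    exact MatTwo.autMap_comp _ _ φ

/-- The scheme `PGL₂` over `ℤ`, as the scheme of algebra automorphisms of the `2 × 2` matrix
algebra. -/
abbrev PGLTwo : Scheme.{0} := Spec (CommRingCat.of MatTwo.AutRing)

/-- `PGL₂` represents the functor `T ↦ Aut(M₂(𝒪_T))`. -/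
def pglRepresentable : (autFunctor ⋙ forget GrpCat).RepresentableBy PGLTwo where
  homEquiv {T} := (specPoint MatTwo.AutRing T).trans MatTwo.autPoint
  homEquiv_comp {T T'} g f := by
    change MatTwo.autMap (specPoint MatTwo.AutRing T (g ≫ f)) MatTwo.univAut =
      MatTwo.autMap g.appTop.hom (MatTwo.autMap (specPoint MatTwo.AutRing T' f) MatTwo.univAut)
    rw [specPoint_comp, MatTwo.autMap_comp]

instance PGLTwo.grpObj : GrpObj PGLTwo := GrpObj.ofRepresentableBy PGLTwo autFunctor pglRepresentable

/-- The algebra automorphism of `M₂(𝒪_T)` given by a `T`-valued point of `PGL₂`. -/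
def PGLTwo.aut {T : Scheme.{0}} (g : T ⟶ PGLTwo) :
    Matrix (Fin 2) (Fin 2) Γ(T, ⊤) ≃ₐ[Γ(T, ⊤)] Matrix (Fin 2) (Fin 2) Γ(T, ⊤) :=
  pglRepresentable.homEquiv g

theorem PGLTwo.aut_comp {T T' : Scheme.{0}} (f : T' ⟶ T) (g : T ⟶ PGLTwo) :
    PGLTwo.aut (f ≫ g) = MatTwo.autMap f.appTop.hom (PGLTwo.aut g) :=
  pglRepresentable.homEquiv_comp f g

theorem PGLTwo.aut_one {T : Scheme.{0}} : PGLTwo.aut (toUnit T ≫ MonObj.one) = 1 := by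
  rw [PGLTwo.aut_comp]
  have : PGLTwo.aut (MonObj.one (X := PGLTwo)) = 1 :=
    pglRepresentable.homEquiv.apply_symm_apply _
  rw [this, map_one]

theorem PGLTwo.aut_mul {T : Scheme.{0}} (g h : T ⟶ PGLTwo) :
    PGLTwo.aut (lift g h ≫ MonObj.mul) = PGLTwo.aut g * PGLTwo.aut h := by
  rw [PGLTwo.aut_comp]
  have : PGLTwo.aut (MonObj.mul (X := PGLTwo)) =
      PGLTwo.aut (fst PGLTwo PGLTwo) * PGLTwo.aut (snd PGLTwo PGLTwo) :=
    pglRepresentable.homEquiv.apply_symm_apply _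
  rw [this, map_mul, ← PGLTwo.aut_comp, ← PGLTwo.aut_comp, lift_fst, lift_snd]

/-! ### Representations of degree `2` -/

/-- A representation of degree `2` of a monoid `M` on a scheme `T`. -/
abbrev RepOn (M : Type) [Monoid M] (T : Scheme.{0}) : Type :=
  M →* Matrix (Fin 2) (Fin 2) Γ(T, ⊤)

/-- The pullback of a representation along a morphism of schemes. -/
def RepOn.pullback {M : Type} [Monoid M] {T T' : Scheme.{0}} (f : T' ⟶ T) (ρ : RepOn M T) :
    RepOn M T' :=
  f.appTop.hom.mapMatrix.toMonoidHom.comp ρ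

namespace RepTwo

def genMat (M : Type) (x : M) : Matrix (Fin 2) (Fin 2) (MvPolynomial (M × Fin 2 × Fin 2) ℤ) :=
  Matrix.of fun i j => MvPolynomial.X (x, i, j)

/-- The relations saying that the generic matrices form a monoid homomorphism. -/
def relIdeal (M : Type) [Monoid M] : Ideal (MvPolynomial (M × Fin 2 × Fin 2) ℤ) :=
  Ideal.span ({p | ∃ i j, p = (genMat M 1 - 1) i j} ∪
    {p | ∃ x y i j, p = (genMat M (x * y) - genMat M x * genMat M y) i j})

def eval {M : Type} [Monoid M] {R : Type} [CommRing R] (ρ : M →* Matrix (Fin 2) (Fin 2) R) :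
    MvPolynomial (M × Fin 2 × Fin 2) ℤ →+* R :=
  (MvPolynomial.aeval (fun p : M × Fin 2 × Fin 2 => ρ p.1 p.2.1 p.2.2)).toRingHom

theorem eval_genMat {M : Type} [Monoid M] {R : Type} [CommRing R]
    (ρ : M →* Matrix (Fin 2) (Fin 2) R) (x : M) : (eval ρ).mapMatrix (genMat M x) = ρ x := by
  ext i j; simp [genMat, eval]

end RepTwo

/-- The coordinate ring `A₂(M)` of the representation variety of degree `2`. -/
abbrev RepRing (M : Type) [Monoid M] : Type :=
  MvPolynomial (M × Fin 2 × Fin 2) ℤ ⧸ RepTwo.relIdeal M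

/-- The universal representation of degree `2` of `M`. -/
def univRep (M : Type) [Monoid M] : M →* Matrix (Fin 2) (Fin 2) (RepRing M) where
  toFun x := (Ideal.Quotient.mk (RepTwo.relIdeal M)).mapMatrix (RepTwo.genMat M x)
  map_one' := by
    rw [← map_one (Ideal.Quotient.mk (RepTwo.relIdeal M)).mapMatrix, ← sub_eq_zero, ← map_sub]
    ext i j
    exact Ideal.Quotient.eq_zero_iff_mem.mpr (Ideal.subset_span (Or.inl ⟨i, j, rfl⟩))
  map_mul' x y := by
    rw [← map_mul, ← sub_eq_zero, ← map_sub]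
    ext i j
    exact Ideal.Quotient.eq_zero_iff_mem.mpr (Ideal.subset_span (Or.inr ⟨x, y, i, j, rfl⟩))

/-- `A₂(M)` represents the functor of representations of degree `2` on rings. -/
def repPoint (M : Type) [Monoid M] (R : Type) [CommRing R] :
    (RepRing M →+* R) ≃ (M →* Matrix (Fin 2) (Fin 2) R) where
  toFun f := f.mapMatrix.toMonoidHom.comp (univRep M)
  invFun ρ := Ideal.Quotient.lift (RepTwo.relIdeal M) (RepTwo.eval ρ) (fun a ha => by
    have : RepTwo.relIdeal M ≤ RingHom.ker (RepTwo.eval ρ) := by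
      refine Ideal.span_le.mpr ?_
      rintro _ (⟨i, j, rfl⟩ | ⟨x, y, i, j, rfl⟩)
      · have h : (RepTwo.eval ρ).mapMatrix (RepTwo.genMat M 1 - 1) = 0 := by
          rw [map_sub, map_one, RepTwo.eval_genMat, map_one, sub_self]
        exact congrFun (congrFun h i) j
      · have h : (RepTwo.eval ρ).mapMatrix
            (RepTwo.genMat M (x * y) - RepTwo.genMat M x * RepTwo.genMat M y) = 0 := by
          rw [map_sub, map_mul, RepTwo.eval_genMat, RepTwo.eval_genMat, RepTwo.eval_genMat,
            map_mul, sub_self]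
        exact congrFun (congrFun h i) j
    exact this ha)
  left_inv f := by
    refine Ideal.Quotient.ringHom_ext (MvPolynomial.ringHom_ext (fun n => by simp) ?_)
    rintro ⟨x, i, j⟩
    simp [univRep, RepTwo.genMat, RepTwo.eval]
  right_inv ρ := by
    ext1 x
    exact RepTwo.eval_genMat ρ x

/-- The representation variety `Rep₂(M)`. -/
abbrev RepVar (M : Type) [Monoid M] : Scheme.{0} := Spec (CommRingCat.of (RepRing M))

/-- `T`-valued points of `Rep₂(M)` are representations of degree `2` of `M` on `T`. -/
def repVarPoint (M : Type) [Monoid M] (T : Scheme.{0}) : (T ⟶ RepVar M) ≃ RepOn M T :=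
  (specPoint (RepRing M) T).trans (repPoint M Γ(T, ⊤))

theorem repVarPoint_comp (M : Type) [Monoid M] {T T' : Scheme.{0}} (g : T' ⟶ T)
    (f : T ⟶ RepVar M) :
    repVarPoint M T' (g ≫ f) = (repVarPoint M T f).pullback g := by
  change repPoint M _ (specPoint (RepRing M) T' (g ≫ f)) = _
  rw [specPoint_comp]
  rfl

/-- The action of `PGL₂` on `Rep₂(M)`: the automorphism `φ` sends `ρ` to `φ ∘ ρ`. -/
def repAct (M : Type) [Monoid M] : PGLTwo ⊗ RepVar M ⟶ RepVar M :=
  (repVarPoint M (PGLTwo ⊗ RepVar M)).symm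
    ((PGLTwo.aut (fst PGLTwo (RepVar M))).toRingEquiv.toMonoidHom.comp
      (repVarPoint M _ (snd PGLTwo (RepVar M))))

theorem repVarPoint_act (M : Type) [Monoid M] {T : Scheme.{0}} (g : T ⟶ PGLTwo)
    (f : T ⟶ RepVar M) (x : M) :
    repVarPoint M T (lift g f ≫ repAct M) x = PGLTwo.aut g (repVarPoint M T f x) := by
  rw [repVarPoint_comp, repAct, Equiv.apply_symm_apply]
  have h1 := PGLTwo.aut_comp (lift g f) (fst PGLTwo (RepVar M))
  have h2 := repVarPoint_comp M (lift g f) (snd PGLTwo (RepVar M))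
  rw [lift_fst] at h1
  rw [lift_snd] at h2
  rw [h1, h2]
  exact (MatTwo.autMap_mapMatrix (lift g f).appTop.hom (PGLTwo.aut (fst PGLTwo (RepVar M)))
    (repVarPoint M _ (snd PGLTwo (RepVar M)) x)).symm

instance RepVar.modObj (M : Type) [Monoid M] : ModObj PGLTwo (RepVar M) where
  smul := repAct M
  one_smul := by
    apply (repVarPoint M _).injective
    ext1 x
    have h : MonObj.one ▷ RepVar M =
        lift (toUnit (𝟙_ Scheme ⊗ RepVar M) ≫ MonObj.one (X := PGLTwo)) (snd _ _) := by
      ext <;> simp [toUnit_unique (toUnit (𝟙_ Scheme ⊗ RepVar M)) (fst _ _)]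
    change repVarPoint M _ (MonObj.one ▷ RepVar M ≫ repAct M) x =
      repVarPoint M _ (λ_ (RepVar M)).hom x
    rw [h, repVarPoint_act, PGLTwo.aut_one, leftUnitor_hom]
    rfl
  mul_smul := by
    apply (repVarPoint M _).injective
    ext1 x
    have h1 : MonObj.mul ▷ RepVar M =
        lift (lift (fst _ _ ≫ fst _ _) (fst _ _ ≫ snd _ _) ≫ MonObj.mul (X := PGLTwo))
          (snd (PGLTwo ⊗ PGLTwo) (RepVar M)) := by
      ext <;> simp [← comp_lift]
    have h2 : (α_ PGLTwo PGLTwo (RepVar M)).hom ≫ PGLTwo ◁ repAct M =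
        lift (fst _ _ ≫ fst _ _) (lift (fst _ _ ≫ snd _ _) (snd _ _) ≫ repAct M) := by
      ext
      · simp
      · rw [Category.assoc, whiskerLeft_snd, lift_snd, ← Category.assoc]
        refine congrArg (· ≫ repAct M) ?_
        ext <;> simp
    change repVarPoint M _ (MonObj.mul ▷ RepVar M ≫ repAct M) x =
      repVarPoint M _ ((α_ PGLTwo PGLTwo (RepVar M)).hom ≫ PGLTwo ◁ repAct M ≫ repAct M) x
    rw [h1, ← Category.assoc, h2, repVarPoint_act, repVarPoint_act, repVarPoint_act,
      PGLTwo.aut_mul]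
    rfl

/-! ### Molds of rank `2` -/

/-- The restriction of a representation on `X` to the open set `U`. -/
def RepOn.restrict {M : Type} [Monoid M] {X : Scheme.{0}} (ρ : RepOn M X) (U : X.Opens) :
    M →* Matrix (Fin 2) (Fin 2) Γ(X, U) :=
  (X.presheaf.map (homOfLE le_top : U ⟶ ⊤).op).hom.mapMatrix.toMonoidHom.comp ρ

/-- The subalgebra of `M₂(𝒪_X(U))` generated by the image of a representation. For affine `U`
these are the sections over `U` of the `𝒪_X`-subalgebra of `M₂(𝒪_X)` generated by the image. -/
def RepOn.image {M : Type} [Monoid M] {X : Scheme.{0}} (ρ : RepOn M X) (U : X.Opens) :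
    Subalgebra Γ(X, U) (Matrix (Fin 2) (Fin 2) Γ(X, U)) :=
  Algebra.adjoin Γ(X, U) (Set.range (ρ.restrict U))

/-- The restriction to `W` of the `𝒪_X`-subalgebra of `M₂(𝒪_X)` generated by the image of `ρ` is a
mold of rank `r`: its quotient is locally free, and it is itself (locally free) of rank `r`. -/
def RepOn.GeneratesMold {M : Type} [Monoid M] {X : Scheme.{0}} (ρ : RepOn M X) (r : ℕ)
    (W : X.Opens) : Prop :=
  ∀ x ∈ W, ∃ U : X.Opens, x ∈ U ∧ U ≤ W ∧ IsAffineOpen U ∧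
    Module.Free Γ(X, U)
      (Matrix (Fin 2) (Fin 2) Γ(X, U) ⧸ Subalgebra.toSubmodule (ρ.image U)) ∧
    Module.Free Γ(X, U) (ρ.image U) ∧ Module.finrank Γ(X, U) (ρ.image U) = r

/-- The ideal generated by the `3 × 3` minors of the `4 × 3` matrices whose columns are the
entries of the universal representation at three elements of the monoid. -/
def minorIdeal (M : Type) [Monoid M] : Ideal (RepRing M) :=
  Ideal.span {p | ∃ (c : Fin 3 → M) (e : Fin 3 ↪ Fin 2 × Fin 2),
    p = (Matrix.of fun i j => univRep M (c j) (e i).1 (e i).2).det}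

/-- The closed subscheme `Rep₂(M)_{rk ≤ 2}` of `Rep₂(M)`. -/
abbrev RepRkLe (M : Type) [Monoid M] : Scheme.{0} :=
  Spec (CommRingCat.of (RepRing M ⧸ minorIdeal M))

/-- The inclusion of `Rep₂(M)_{rk ≤ 2}` into `Rep₂(M)`. -/
def repRkLeι (M : Type) [Monoid M] : RepRkLe M ⟶ RepVar M :=
  Spec.map (CommRingCat.ofHom (Ideal.Quotient.mk (minorIdeal M)))

/-- The tautological representation on `Rep₂(M)_{rk ≤ 2}`. -/
def repRkLeTaut (M : Type) [Monoid M] : RepOn M (RepRkLe M) :=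
  repVarPoint M (RepRkLe M) (repRkLeι M)

/-- The open set of `Rep₂(M)_{rk ≤ 2}` where the tautological representation generates a mold of
rank `2`. -/
def rkTwoLocus (M : Type) [Monoid M] : (RepRkLe M).Opens :=
  sSup {W | (repRkLeTaut M).GeneratesMold 2 W}

/-- The scheme `Rep₂(M)_{rk 2}` of representations generating a mold of rank `2`. -/
def RepRkTwo (M : Type) [Monoid M] : Scheme.{0} := (rkTwoLocus M).toScheme

/-- The inclusion of `Rep₂(M)_{rk 2}` into `Rep₂(M)`. -/
def repRkTwoι (M : Type) [Monoid M] : RepRkTwo M ⟶ RepVar M :=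
  (rkTwoLocus M).ι ≫ repRkLeι M

/-! ### The character variety -/

/-- The subring `A₂(M)^Ch` of `A₂(M)` generated by the traces and determinants of the universal
representation. -/
def chRing (M : Type) [Monoid M] : Subalgebra ℤ (RepRing M) :=
  Algebra.adjoin ℤ {p | ∃ x, p = (univRep M x).trace ∨ p = (univRep M x).det}

def chTrace (M : Type) [Monoid M] (x : M) : chRing M :=
  ⟨(univRep M x).trace, Algebra.subset_adjoin ⟨x, Or.inl rfl⟩⟩

def chDet (M : Type) [Monoid M] (x : M) : chRing M :=
  ⟨(univRep M x).det, Algebra.subset_adjoin ⟨x, Or.inr rfl⟩⟩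

/-- The scheme `Ch₂(M)`. -/
abbrev ChVar (M : Type) [Monoid M] : Scheme.{0} := Spec (CommRingCat.of (chRing M))

/-- The canonical morphism `Rep₂(M) → Ch₂(M)`. -/
def repToCh (M : Type) [Monoid M] : RepVar M ⟶ ChVar M :=
  Spec.map (CommRingCat.ofHom (chRing M).val.toRingHom)

/-- The canonical morphism `π : Rep₂(M)_{rk 2} → Ch₂(M)`. -/
def rkTwoToCh (M : Type) [Monoid M] : RepRkTwo M ⟶ ChVar M :=
  repRkTwoι M ≫ repToCh M

/-! ### Geometric quotients -/

/-- `φ : X → Y` is a geometric quotient of `X` by `G` for the action `σ : G × X → X`. Products are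
taken in the category of schemes, that is, over `Spec ℤ`. -/
structure IsGeometricQuotient {G X Y : Scheme.{0}} (σ : G ⊗ X ⟶ X) (φ : X ⟶ Y) : Prop where
  /-- `φ` is invariant. -/
  invariant : σ ≫ φ = snd G X ≫ φ
  /-- `φ` is surjective. -/
  surjective : Function.Surjective φ
  /-- The image of `(σ, p₂) : G × X → X × X` is `X ×_Y X`. -/
  range_eq : Set.range (lift σ (snd G X)) =
    Set.range (lift (pullback.fst φ φ) (pullback.snd φ φ))
  /-- `φ` is submersive. -/
  submersive : ∀ U : Set Y, IsOpen (φ ⁻¹' U) → IsOpen U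
  /-- `𝒪_Y → φ_* 𝒪_X` is injective. -/
  app_injective : ∀ U : Y.Opens, Function.Injective (φ.app U)
  /-- The image of `𝒪_Y → φ_* 𝒪_X` consists of the invariant functions. -/
  mem_range_iff : ∀ (U : Y.Opens) (f : Γ(X, φ ⁻¹ᵁ U)),
    f ∈ Set.range (φ.app U) ↔
      σ.appLE (φ ⁻¹ᵁ U) (snd G X ⁻¹ᵁ (φ ⁻¹ᵁ U))
        (by rw [← Scheme.Hom.comp_preimage, ← Scheme.Hom.comp_preimage, invariant]) f =
      (snd G X).app (φ ⁻¹ᵁ U) f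

/-- The action of `G` on `X ×_Y Y'` induced by an action `σ` of `G` on `X` for which `φ : X → Y` is
invariant. -/
def baseChangeAct {G X Y Y' : Scheme.{0}} (σ : G ⊗ X ⟶ X) (φ : X ⟶ Y)
    (h : σ ≫ φ = snd G X ≫ φ) (g : Y' ⟶ Y) :
    G ⊗ pullback φ g ⟶ pullback φ g :=
  pullback.lift (G ◁ pullback.fst φ g ≫ σ) (snd G (pullback φ g) ≫ pullback.snd φ g) (by
    rw [Category.assoc, h, whiskerLeft_snd_assoc, pullback.condition, Category.assoc])

/-- `φ : X → Y` is a universal geometric quotient of `X` by `G` for the action `σ`: every base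
change `X ×_Y Y' → Y'` is a geometric quotient for the induced action. -/
def IsUniversalGeometricQuotient {G X Y : Scheme.{0}} (σ : G ⊗ X ⟶ X) (φ : X ⟶ Y) : Prop :=
  ∃ h : σ ≫ φ = snd G X ≫ φ, ∀ (Y' : Scheme.{0}) (g : Y' ⟶ Y),
    IsGeometricQuotient (baseChangeAct σ φ h g) (pullback.snd φ g)

end

/-!
The matrix `A = ρ(α)` determines a representation of the free monoid of rank one. By the
Cayley–Hamilton theorem the algebra it generates is spanned by `1` and `A`; so `Rep₂(Υ)_{rk ≤ 2}` is
all of `Rep₂(Υ)` (`minorIdeal_freeMonoid`), and the algebra is a mold of rank `2` exactly where `A` is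
not scalar (`rkTwoLocus_eq_nonScalar`). Thus `T`-valued points of `Rep₂(Υ)_{rk 2}` are matrices of
functions on `T` that are nowhere scalar. The character ring is generated by `tr A` and `det A`, and
evaluating at a companion matrix shows that they are algebraically independent.

Two facts make `π` a universal geometric quotient. First, the companion matrix of `X² - tX + d`
defines a section of `π` (`exists_section_rkTwoToCh`). Second, a matrix `A` that is not scalar at a
point has a cyclic vector `v` there, one of `(1, 0)`, `(0, 1)`, `(1, 1)`; near that point the matrix
with columns `v`, `A v` is invertible and conjugates `A` to its companion matrix. Hence any two
`T`-valued points of `Rep₂(Υ)_{rk 2}` with the same image under `π` are conjugate locally on `T`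
(`isLocallyTransitive_act`).

An invariant morphism `φ` with a section `s` and this local transitivity is a geometric quotient
(`IsLocallyTransitive.isGeometricQuotient`): the section gives surjectivity, submersivity and the
injectivity of `𝒪_Y → φ_* 𝒪_X`, while transitivity describes `X ×_Y X` and shows that an invariant
function `f` equals `φ^* s^* f`. Invariance, the section and local transitivity are all stable under
base change, so the quotient is universal.

Invariance of `π` requires that every algebra automorphism of `M₂(R)`, inner or not, preserve the
trace and the determinant; this too follows from the Cayley–Hamilton theorem
(`MatTwo.trace_algEquiv`).
-/

noncomputable section

/-! ### Geometric quotients with a section -/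

/-- The action `σ` of `G` on `X` is locally transitive on the fibres of `φ`: any two `T`-valued
points of `X` with the same image under `φ` are conjugate by a `T`-valued point of `G`, locally on
`T` for the Zariski topology. -/
def IsLocallyTransitive {G X Y : Scheme.{0}} (σ : G ⊗ X ⟶ X) (φ : X ⟶ Y) : Prop :=
  ∀ (T : Scheme.{0}) (x y : T ⟶ X), x ≫ φ = y ≫ φ → ∀ t : T,
    ∃ (V : T.Opens) (_ : t ∈ V) (g : V.toScheme ⟶ G), lift g (V.ι ≫ y) ≫ σ = V.ι ≫ x

theorem IsLocallyTransitive.baseChange {G X Y Y' : Scheme.{0}} {σ : G ⊗ X ⟶ X} {φ : X ⟶ Y}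
    (ht : IsLocallyTransitive σ φ) (h : σ ≫ φ = snd G X ≫ φ) (g : Y' ⟶ Y) :
    IsLocallyTransitive (baseChangeAct σ φ h g) (pullback.snd φ g) := by
  intro T x y hxy t
  obtain ⟨V, hV, γ, hγ⟩ := ht T (x ≫ pullback.fst φ g) (y ≫ pullback.fst φ g) (by
    simp only [Category.assoc, pullback.condition, reassoc_of% hxy]) t
  refine ⟨V, hV, γ, pullback.hom_ext ?_ ?_⟩
  · simp only [baseChangeAct, Category.assoc, pullback.lift_fst, lift_whiskerLeft_assoc, hγ]
  · simp only [baseChangeAct, Category.assoc, pullback.lift_snd, lift_snd_assoc, hxy]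

theorem section_ext_of_forall_mem {X : Scheme.{0}} {W : X.Opens} {f f' : Γ(X, W)}
    (H : ∀ x ∈ W, ∃ (V : X.Opens) (_ : x ∈ V), V.ι.app W f = V.ι.app W f') : f = f' := by
  refine TopCat.Presheaf.section_ext X.sheaf W f f' fun x hx => ?_
  obtain ⟨V, hV, h⟩ := H x hx
  let y : V.toScheme := ⟨x, hV⟩
  refine (ConcreteCategory.bijective_of_isIso (V.ι.stalkMap y)).1 ?_
  exact (Scheme.Hom.germ_stalkMap_apply V.ι W y hx f).trans
    ((congrArg (V.toScheme.presheaf.germ (V.ι ⁻¹ᵁ W) y hx) h).trans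
      (Scheme.Hom.germ_stalkMap_apply V.ι W y hx f').symm)

theorem appLE_congr_hom {X Y : Scheme.{0}} {k k' : X ⟶ Y} (h : k = k') (U : Y.Opens)
    (V : X.Opens) (e : V ≤ k ⁻¹ᵁ U) :
    k.appLE U V e = k'.appLE U V (by rw [← h]; exact e) := by
  subst h; rfl

section Section

variable {G X Y : Scheme.{0}} {σ : G ⊗ X ⟶ X} {φ : X ⟶ Y} {s : Y ⟶ X}

theorem preimage_preimage_of_section (hs : s ≫ φ = 𝟙 Y) (U : Y.Opens) :
    U = s ⁻¹ᵁ (φ ⁻¹ᵁ U) := by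
  rw [← Scheme.Hom.comp_preimage, hs]; rfl

/-- Pulling back along a section of `φ` is a left inverse of `φ.app U`. -/
theorem appLE_section_app (hs : s ≫ φ = 𝟙 Y) (U : Y.Opens) (f : Γ(Y, U)) :
    s.appLE (φ ⁻¹ᵁ U) U (preimage_preimage_of_section hs U).le (φ.app U f) = f := by
  have h : φ.app U ≫ s.appLE (φ ⁻¹ᵁ U) U (preimage_preimage_of_section hs U).le =
      (s ≫ φ).appLE U U (preimage_preimage_of_section hs U).le :=
    (Scheme.Hom.comp_appLE s φ U U _).symm
  have h2 : (s ≫ φ).appLE U U (preimage_preimage_of_section hs U).le = 𝟙 _ :=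
    (appLE_congr_hom hs U U (preimage_preimage_of_section hs U).le).trans
      (Scheme.Hom.appLE_eq_app (𝟙 Y))
  exact congrArg (fun k => k.hom f) (h.trans h2)

/-- An invariant function `f` is the pullback of its restriction to the section `s`: near each
point, the identity of `X` is a translate of `φ ≫ s` by a point of `G`, so `f` and `φ^* s^* f` agree
there. -/
theorem IsLocallyTransitive.app_section_of_invariant (hs : s ≫ φ = 𝟙 Y)
    (ht : IsLocallyTransitive σ φ) (U : Y.Opens) (f : Γ(X, φ ⁻¹ᵁ U))
    (e : snd G X ⁻¹ᵁ (φ ⁻¹ᵁ U) ≤ σ ⁻¹ᵁ (φ ⁻¹ᵁ U))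
    (hf : σ.appLE (φ ⁻¹ᵁ U) (snd G X ⁻¹ᵁ (φ ⁻¹ᵁ U)) e f = (snd G X).app (φ ⁻¹ᵁ U) f) :
    φ.app U (s.appLE (φ ⁻¹ᵁ U) U (preimage_preimage_of_section hs U).le f) = f := by
  refine section_ext_of_forall_mem fun x hx => ?_
  obtain ⟨V, hV, g, hg⟩ := ht X (𝟙 X) (φ ≫ s) (by simp [hs]) x
  refine ⟨V, hV, ?_⟩
  rw [Category.comp_id] at hg
  have hle2 : V.ι ⁻¹ᵁ (φ ⁻¹ᵁ U) ≤ (V.ι ≫ φ ≫ s) ⁻¹ᵁ (φ ⁻¹ᵁ U) :=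
    (congrArg (fun U' => V.ι ⁻¹ᵁ (φ ⁻¹ᵁ U')) (preimage_preimage_of_section hs U)).le
  have hle : V.ι ⁻¹ᵁ (φ ⁻¹ᵁ U) ≤
      lift g (V.ι ≫ φ ≫ s) ⁻¹ᵁ (snd G X ⁻¹ᵁ (φ ⁻¹ᵁ U)) :=
    hle2.trans (congrArg (fun k => k ⁻¹ᵁ (φ ⁻¹ᵁ U)) (lift_snd g (V.ι ≫ φ ≫ s))).ge
  -- The invariance of `f`, pulled back along the point `(g, s ∘ φ)` of `G ⊗ X`.
  have h1 := congrArg ((lift g (V.ι ≫ φ ≫ s)).appLE _ _ hle).hom hf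
  rw [← Scheme.Hom.appLE_eq_app] at h1
  have c1 := Scheme.Hom.appLE_comp_appLE (lift g (V.ι ≫ φ ≫ s)) σ (φ ⁻¹ᵁ U) _ _ e hle
  have c2 := Scheme.Hom.appLE_comp_appLE (lift g (V.ι ≫ φ ≫ s)) (snd G X) (φ ⁻¹ᵁ U) _ _ le_rfl hle
  have d1 := congrArg (fun k => k.hom f) c1
  have d2 := congrArg (fun k => k.hom f) c2
  have h2 := d1.symm.trans (h1.trans d2)
  rw [appLE_congr_hom hg, appLE_congr_hom (lift_snd _ _)] at h2
  rw [Scheme.Hom.app_eq_appLE, Scheme.Hom.app_eq_appLE]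
  refine Eq.trans ?_ h2.symm
  have c3 := Scheme.Hom.appLE_comp_appLE φ s (φ ⁻¹ᵁ U) U (φ ⁻¹ᵁ U)
    (preimage_preimage_of_section hs U).le le_rfl
  have c4 := Scheme.Hom.appLE_comp_appLE V.ι (φ ≫ s) (φ ⁻¹ᵁ U) (φ ⁻¹ᵁ U) (V.ι ⁻¹ᵁ (φ ⁻¹ᵁ U))
    (congrArg (fun U' => φ ⁻¹ᵁ U') (preimage_preimage_of_section hs U)).le le_rfl
  rw [← c3] at c4
  exact congrArg (fun k => k.hom f) c4

/-- An invariant morphism with a section is a geometric quotient if the action is locally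
transitive on its fibres. -/
theorem IsLocallyTransitive.isGeometricQuotient (h : σ ≫ φ = snd G X ≫ φ) (hs : s ≫ φ = 𝟙 Y)
    (ht : IsLocallyTransitive σ φ) : IsGeometricQuotient σ φ where
  invariant := h
  surjective y := ⟨s y, by rw [← Scheme.Hom.comp_apply, hs]; rfl⟩
  range_eq := by
    apply subset_antisymm
    · rintro _ ⟨z, rfl⟩
      refine ⟨pullback.lift σ (snd G X) h z, ?_⟩
      rw [← Scheme.Hom.comp_apply, comp_lift, pullback.lift_fst, pullback.lift_snd]
    · rintro _ ⟨z, rfl⟩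
      obtain ⟨V, hV, g, hg⟩ := ht _ (pullback.fst φ φ) (pullback.snd φ φ) pullback.condition z
      refine ⟨lift g (V.ι ≫ pullback.snd φ φ) ⟨z, hV⟩, ?_⟩
      have key : lift g (V.ι ≫ pullback.snd φ φ) ≫ lift σ (snd G X) =
          V.ι ≫ lift (pullback.fst φ φ) (pullback.snd φ φ) := by
        rw [comp_lift, lift_snd, hg, ← comp_lift]
      exact congrArg (fun k : V.toScheme ⟶ X ⊗ X => k ⟨z, hV⟩) key
  submersive U hU := by
    have : U = s ⁻¹' (φ ⁻¹' U) := by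
      rw [← Set.preimage_comp, ← TopCat.coe_comp, ← Scheme.Hom.comp_base, hs]; rfl
    rw [this]
    exact hU.preimage s.continuous
  app_injective U := Function.LeftInverse.injective (appLE_section_app hs U)
  mem_range_iff U f := by
    constructor
    · rintro ⟨f, rfl⟩
      have e : snd G X ⁻¹ᵁ (φ ⁻¹ᵁ U) ≤ σ ⁻¹ᵁ (φ ⁻¹ᵁ U) := by
        rw [← Scheme.Hom.comp_preimage, ← Scheme.Hom.comp_preimage, h]
      have c1 := Scheme.Hom.comp_appLE σ φ U (snd G X ⁻¹ᵁ (φ ⁻¹ᵁ U)) e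
      have c2 := Scheme.Hom.comp_appLE (snd G X) φ U (snd G X ⁻¹ᵁ (φ ⁻¹ᵁ U)) le_rfl
      have := c1.symm.trans ((appLE_congr_hom h _ _ _).trans c2)
      rw [← Scheme.Hom.app_eq_appLE] at this
      exact congrArg (fun k => k.hom f) this
    · intro hf
      exact ⟨_, ht.app_section_of_invariant hs U f _ hf⟩

/-- Sections and local transitivity are inherited by base changes, so the quotient is universal. -/
theorem IsLocallyTransitive.isUniversalGeometricQuotient (h : σ ≫ φ = snd G X ≫ φ)
    (hs : s ≫ φ = 𝟙 Y) (ht : IsLocallyTransitive σ φ) : IsUniversalGeometricQuotient σ φ := by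
  refine ⟨h, fun Y' g => ?_⟩
  exact (ht.baseChange h g).isGeometricQuotient
    (s := pullback.lift (g ≫ s) (𝟙 Y') (by simp [hs])) (pullback.lift_snd _ _ _)
    (pullback.lift_snd _ _ _)

end Section

/-! ### Two by two matrices -/

namespace MatTwo

variable {R : Type*} [CommRing R]

theorem mul_self_eq (A : Matrix (Fin 2) (Fin 2) R) : A * A = A.trace • A - A.det • 1 := by
  ext i j
  fin_cases i <;> fin_cases j <;>
    simp [Matrix.mul_apply, Matrix.trace, Matrix.det_fin_two] <;> ring

/-- The coefficients in `A ^ n = p • 1 + q • A` can be taken in any subalgebra that contains the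
trace and the determinant of `A`. -/
theorem exists_pow_eq {S : Type*} [CommRing S] [Algebra S R] (S' : Subalgebra S R)
    (A : Matrix (Fin 2) (Fin 2) R) (ht : A.trace ∈ S') (hd : A.det ∈ S') (n : ℕ) :
    ∃ p ∈ S', ∃ q ∈ S', A ^ n = p • 1 + q • A := by
  induction n with
  | zero => exact ⟨1, one_mem _, 0, zero_mem _, by simp⟩
  | succ n ih =>
    obtain ⟨p, hp, q, hq, h⟩ := ih
    refine ⟨-(q * A.det), neg_mem (mul_mem hq hd), p + q * A.trace,
      add_mem hp (mul_mem hq ht), ?_⟩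
    rw [pow_succ, h, add_mul, smul_mul_assoc, smul_mul_assoc, one_mul, mul_self_eq]
    module

/-- Over any commutative ring, algebra automorphisms of the matrix algebra preserve the trace:
comparing the Cayley–Hamilton equations of `X` and `φ X` shows that `(tr φ X - tr X) • X` is a
scalar matrix, which for a matrix unit `X` forces `tr φ X = tr X`. -/
theorem trace_algEquiv (φ : Matrix (Fin 2) (Fin 2) R ≃ₐ[R] Matrix (Fin 2) (Fin 2) R)
    (X : Matrix (Fin 2) (Fin 2) R) : (φ X).trace = X.trace := by
  have key (X : Matrix (Fin 2) (Fin 2) R) :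
      ((φ X).trace - X.trace) • X = ((φ X).det - X.det) • (1 : Matrix (Fin 2) (Fin 2) R) := by
    apply φ.injective
    have h1 := congrArg φ (mul_self_eq X)
    rw [map_mul, mul_self_eq, map_sub, map_smul, map_smul, map_one] at h1
    rw [map_smul, map_smul, map_one, sub_smul, sub_smul, sub_eq_sub_iff_sub_eq_sub, h1]
  have hunit (i j : Fin 2) :
      (φ (Matrix.single i j 1)).trace = (Matrix.single i j (1 : R)).trace := by
    have h (s t : Fin 2) := congrFun (congrFun (key (Matrix.single i j 1)) s) t
    rw [← sub_eq_zero]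
    have h00 := h 0 0
    have h01 := h 0 1
    have h10 := h 1 0
    have h11 := h 1 1
    fin_cases i <;> fin_cases j <;> simp [Matrix.det_fin_two] at h00 h01 h10 h11 ⊢ <;> grind
  rw [← aut_sum φ X]
  conv_rhs => rw [Matrix.matrix_eq_sum_single X]
  simp only [Matrix.trace_sum, Matrix.trace_smul, hunit]
  refine Finset.sum_congr rfl fun i _ => Finset.sum_congr rfl fun j _ => ?_
  rw [← Matrix.trace_smul]; simp

theorem det_algEquiv (φ : Matrix (Fin 2) (Fin 2) R ≃ₐ[R] Matrix (Fin 2) (Fin 2) R)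
    (X : Matrix (Fin 2) (Fin 2) R) : (φ X).det = X.det := by
  have h1 := congrArg φ (mul_self_eq X)
  rw [map_mul, mul_self_eq, map_sub, map_smul, map_smul, map_one, trace_algEquiv,
    sub_right_inj] at h1
  simpa using congrFun (congrFun h1 0) 0

/-- The companion matrix of `X ^ 2 - t X + d`. -/
def companion (t d : R) : Matrix (Fin 2) (Fin 2) R := !![0, -d; 1, t]

theorem trace_companion (t d : R) : (companion t d).trace = t := by
  simp [companion, Matrix.trace]

theorem det_companion (t d : R) : (companion t d).det = d := by
  simp [companion, Matrix.det_fin_two]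

/-- The matrix with columns `v` and `A v`, where `v = (x, y)`. -/
def krylov (A : Matrix (Fin 2) (Fin 2) R) (x y : R) : Matrix (Fin 2) (Fin 2) R :=
  !![x, A 0 0 * x + A 0 1 * y; y, A 1 0 * x + A 1 1 * y]

theorem mul_krylov (A : Matrix (Fin 2) (Fin 2) R) (x y : R) :
    A * krylov A x y = krylov A x y * companion A.trace A.det := by
  ext i j
  fin_cases i <;> fin_cases j <;>
    simp [krylov, companion, Matrix.mul_apply, Matrix.trace, Matrix.det_fin_two] <;> ring

theorem det_krylov (A : Matrix (Fin 2) (Fin 2) R) (x y : R) :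
    (krylov A x y).det = A 1 0 * x ^ 2 - (A 0 0 - A 1 1) * (x * y) - A 0 1 * y ^ 2 := by
  simp only [krylov, Matrix.det_fin_two_of]; ring

theorem map_krylov {S : Type*} [CommRing S] (f : R →+* S) (A : Matrix (Fin 2) (Fin 2) R)
    (x y : R) : f.mapMatrix (krylov A x y) = krylov (f.mapMatrix A) (f x) (f y) := by
  ext i j; fin_cases i <;> fin_cases j <;> simp [krylov]

/-- Conjugation by an invertible matrix. -/
def conj (P : (Matrix (Fin 2) (Fin 2) R)ˣ) :
    Matrix (Fin 2) (Fin 2) R ≃ₐ[R] Matrix (Fin 2) (Fin 2) R :=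
  MulSemiringAction.toAlgEquiv R _ (ConjAct.toConjAct P)

theorem conj_apply (P : (Matrix (Fin 2) (Fin 2) R)ˣ) (X : Matrix (Fin 2) (Fin 2) R) :
    conj P X = P * X * (↑P⁻¹ : Matrix (Fin 2) (Fin 2) R) :=
  ConjAct.units_smul_def _ _

/-- Two matrices with cyclic vectors and the same characteristic polynomial are conjugate. -/
theorem exists_conj_eq {A B : Matrix (Fin 2) (Fin 2) R} {x y z w : R}
    (hA : IsUnit (krylov A x y).det) (hB : IsUnit (krylov B z w).det)
    (ht : A.trace = B.trace) (hd : A.det = B.det) :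
    ∃ φ : Matrix (Fin 2) (Fin 2) R ≃ₐ[R] Matrix (Fin 2) (Fin 2) R, φ B = A := by
  obtain ⟨P, hP⟩ := (Matrix.isUnit_iff_isUnit_det _).mpr hA
  obtain ⟨Q, hQ⟩ := (Matrix.isUnit_iff_isUnit_det _).mpr hB
  have h1 := mul_krylov A x y
  have h2 := mul_krylov B z w
  rw [← hP] at h1
  rw [← hQ, ← ht, ← hd] at h2
  refine ⟨conj (P * Q⁻¹), ?_⟩
  rw [conj_apply, mul_inv_rev, inv_inv, Units.val_mul, Units.val_mul]
  rw [mul_assoc, mul_assoc, ← mul_assoc B, h2, mul_assoc, Units.inv_mul_cancel_left,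
    ← mul_assoc, ← h1, mul_assoc, Units.mul_inv, mul_one]

/-- If `A` has a cyclic vector, then `1` and `A` are a basis of their span, and the quotient of the
matrix algebra by that span is free: conjugation reduces this to companion matrices. -/
theorem free_span_one_self {A : Matrix (Fin 2) (Fin 2) R} {x y : R}
    (hA : IsUnit (krylov A x y).det) :
    Nonempty ((Fin 2 → R) ≃ₗ[R] Submodule.span R {1, A}) ∧
      Nonempty ((Matrix (Fin 2) (Fin 2) R ⧸ Submodule.span R {1, A}) ≃ₗ[R] (Fin 2 → R)) := by
  obtain ⟨P, hP⟩ := (Matrix.isUnit_iff_isUnit_det _).mpr hA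
  have h1 := mul_krylov A x y
  rw [← hP] at h1
  set C := companion A.trace A.det with hC
  have hA' : conj P C = A := by
    rw [conj_apply, ← h1, mul_assoc, Units.mul_inv, mul_one]
  -- The linear equations that cut out the span of `1` and `C`, and their translates by `conj P`.
  let ℓ : Matrix (Fin 2) (Fin 2) R →ₗ[R] (Fin 2 → R) :=
    { toFun X := ![X 0 1 + A.det * X 1 0, X 1 1 - X 0 0 - A.trace * X 1 0]
      map_add' X Y := by ext i; fin_cases i <;> simp <;> ring
      map_smul' c X := by ext i; fin_cases i <;> simp <;> ring }
  have hsurj : Function.Surjective ℓ := fun u =>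
    ⟨!![0, u 0; 0, u 1], by ext i; fin_cases i <;> simp [ℓ]⟩
  have hker : LinearMap.ker ℓ = Submodule.span R {1, C} := by
    ext X
    rw [Submodule.mem_span_pair, LinearMap.mem_ker]
    constructor
    · intro h
      have h0 : X 0 1 + A.det * X 1 0 = 0 := congrFun h 0
      have h1 : X 1 1 - X 0 0 - A.trace * X 1 0 = 0 := congrFun h 1
      refine ⟨X 0 0, X 1 0, ?_⟩
      ext i j
      fin_cases i <;> fin_cases j <;> simp [hC, companion] <;> grind
    · rintro ⟨p, q, rfl⟩
      ext i
      fin_cases i <;> simp [ℓ, hC, companion] <;> ring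
  let L := ℓ ∘ₗ (conj P).symm.toLinearMap
  have hLsurj : Function.Surjective L := hsurj.comp (conj P).symm.surjective
  have hLker : LinearMap.ker L = Submodule.span R {1, A} := by
    have : Submodule.span R {1, A} = (Submodule.span R {1, C}).map (conj P).toLinearMap := by
      rw [Submodule.map_span, Set.image_pair]
      simp [hA']
    rw [this, ← hker]
    ext X
    simp only [LinearMap.mem_ker, Submodule.mem_map, L, LinearMap.comp_apply]
    exact ⟨fun h => ⟨_, h, by simp⟩, by rintro ⟨Z, h, rfl⟩; simpa using h⟩
  refine ⟨?_, ⟨(Submodule.quotEquivOfEq _ _ hLker.symm).trans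
    (L.quotKerEquivOfSurjective hLsurj)⟩⟩
  have hind : LinearIndependent R ![1, A] := by
    rw [LinearIndependent.pair_iff]
    intro p q h
    have h2 : p • (1 : Matrix (Fin 2) (Fin 2) R) + q • C = 0 := by
      apply (conj P).injective
      rw [map_add, map_smul, map_smul, map_one, hA', h, map_zero]
    have h00 := congrFun (congrFun h2 0) 0
    have h10 := congrFun (congrFun h2 1) 0
    simp [hC, companion] at h00 h10
    exact ⟨h00, h10⟩
  have hr : Set.range ![1, A] = {1, A} := by simp [Set.pair_comm]
  exact ⟨(Module.Basis.span hind).equivFun.symm.trans (LinearEquiv.ofEq _ _ (by rw [hr]))⟩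

/-- If the span of `1` and `A` is free of rank `2` with free quotient, there is a linear form on
the matrix algebra that separates `A` from `1`. -/
theorem exists_linearForm {A : Matrix (Fin 2) (Fin 2) R}
    (hq : Module.Free R (Matrix (Fin 2) (Fin 2) R ⧸ Submodule.span R {1, A}))
    (e : (Fin 2 → R) ≃ₗ[R] Submodule.span R {1, A}) :
    ∃ μ : Matrix (Fin 2) (Fin 2) R →ₗ[R] R, μ 1 = 0 ∧ μ A = 1 := by
  set N := Submodule.span R {1, A}
  obtain ⟨s, hs⟩ := Module.projective_lifting_property N.mkQ LinearMap.id N.mkQ_surjective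
  have hs' (X) : N.mkQ (s X) = X := congrArg (fun k => k X) hs
  let r : Matrix (Fin 2) (Fin 2) R →ₗ[R] N :=
    (LinearMap.id - s ∘ₗ N.mkQ).codRestrict N fun X => by
      have h : X - s (N.mkQ X) ∈ LinearMap.ker N.mkQ := by
        rw [LinearMap.mem_ker, map_sub, hs', sub_self]
      rwa [Submodule.ker_mkQ] at h
  have hr (X : N) : r X = X := by
    apply Subtype.ext
    have : N.mkQ (X : Matrix (Fin 2) (Fin 2) R) = 0 := by simp
    simp [r, -Submodule.mkQ_apply, this]
  let b : Fin 2 → N := ![⟨1, Submodule.subset_span (by simp)⟩,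
    ⟨A, Submodule.subset_span (by simp)⟩]
  -- A surjective endomorphism of a finite module is injective.
  have hsurj : Function.Surjective (Fintype.linearCombination R b) := by
    rintro ⟨X, hX⟩
    obtain ⟨p, q, rfl⟩ := Submodule.mem_span_pair.mp hX
    exact ⟨![p, q], Subtype.ext (by simp [Fintype.linearCombination_apply, b])⟩
  have hinj : Function.Injective (Fintype.linearCombination R b) := by
    have := OrzechProperty.injective_of_surjective_endomorphism
      (e.symm.toLinearMap ∘ₗ Fintype.linearCombination R b) (e.symm.surjective.comp hsurj)
    exact Function.Injective.of_comp this
  let E := LinearEquiv.ofBijective _ ⟨hinj, hsurj⟩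
  have hE (i : Fin 2) : E.symm (b i) = Pi.single i 1 := by
    rw [LinearEquiv.symm_apply_eq]
    exact (by simp [Fintype.linearCombination_apply_single] :
      b i = Fintype.linearCombination R b (Pi.single i 1))
  refine ⟨LinearMap.proj 1 ∘ₗ E.symm.toLinearMap ∘ₗ r, ?_, ?_⟩
  · have h1 : r 1 = b 0 := hr (b 0)
    simp [h1, hE]
  · have h1 : r A = b 1 := hr (b 1)
    simp [h1, hE]

end MatTwo

/-! ### Representations of the free monoid of rank one -/

theorem FreeMonoid.exists_eq_pow (x : FreeMonoid Unit) : ∃ n : ℕ, x = FreeMonoid.of () ^ n := by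
  induction x using FreeMonoid.inductionOn' with
  | one => exact ⟨0, rfl⟩
  | of_mul a x ih =>
    obtain ⟨n, rfl⟩ := ih
    exact ⟨n + 1, (pow_succ' _ _).symm⟩

theorem exists_rep_eq {R : Type*} [CommRing R] (ρ : FreeMonoid Unit →* Matrix (Fin 2) (Fin 2) R)
    (x : FreeMonoid Unit) : ∃ p q : R, ρ x = p • 1 + q • ρ (FreeMonoid.of ()) := by
  obtain ⟨n, rfl⟩ := FreeMonoid.exists_eq_pow x
  obtain ⟨p, -, q, -, h⟩ := MatTwo.exists_pow_eq (⊤ : Subalgebra R R) (ρ (FreeMonoid.of ()))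
    trivial trivial n
  exact ⟨p, q, by rw [map_pow, h]⟩

theorem toSubmodule_adjoin_range {R : Type*} [CommRing R]
    (ρ : FreeMonoid Unit →* Matrix (Fin 2) (Fin 2) R) :
    Subalgebra.toSubmodule (Algebra.adjoin R (Set.range ρ)) =
      Submodule.span R {1, ρ (FreeMonoid.of ())} := by
  rw [Algebra.adjoin_eq_span, ← MonoidHom.coe_mrange, Submonoid.closure_eq]
  refine le_antisymm (Submodule.span_le.mpr ?_) (Submodule.span_mono ?_)
  · rintro _ ⟨x, rfl⟩
    obtain ⟨p, q, h⟩ := exists_rep_eq ρ x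
    exact Submodule.mem_span_pair.mpr ⟨p, q, h.symm⟩
  · rintro _ (rfl | rfl)
    exacts [one_mem (MonoidHom.mrange ρ), ⟨_, rfl⟩]

/-- All values of a representation are combinations of `1` and one matrix, so the minors vanish. -/
theorem minorIdeal_freeMonoid : minorIdeal (FreeMonoid Unit) = ⊥ := by
  rw [minorIdeal, Ideal.span_eq_bot]
  rintro _ ⟨c, e, rfl⟩
  choose p q h using exists_rep_eq (univRep (FreeMonoid Unit))
  rw [Matrix.det_fin_three]
  simp only [Matrix.of_apply, h (c _), Matrix.add_apply, Matrix.smul_apply, smul_eq_mul]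
  ring

theorem chRing_freeMonoid : chRing (FreeMonoid Unit) =
    Algebra.adjoin ℤ {(univRep (FreeMonoid Unit) (FreeMonoid.of ())).trace,
      (univRep (FreeMonoid Unit) (FreeMonoid.of ())).det} := by
  set A := univRep (FreeMonoid Unit) (FreeMonoid.of ()) with hA
  have ht : A.trace ∈ Algebra.adjoin ℤ {A.trace, A.det} := Algebra.subset_adjoin (by simp)
  have hd : A.det ∈ Algebra.adjoin ℤ {A.trace, A.det} := Algebra.subset_adjoin (by simp)
  refine le_antisymm (Algebra.adjoin_le ?_) (Algebra.adjoin_mono ?_)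
  · rintro _ ⟨x, h⟩
    obtain ⟨n, rfl⟩ := FreeMonoid.exists_eq_pow x
    rw [map_pow, ← hA] at h
    obtain rfl | rfl := h
    · obtain ⟨p, hp, q, hq, h⟩ := MatTwo.exists_pow_eq _ A ht hd n
      rw [h, Matrix.trace_add, Matrix.trace_smul, Matrix.trace_smul]
      exact add_mem (mul_mem hp (by simp)) (mul_mem hq ht)
    · rw [Matrix.det_pow]
      exact pow_mem hd n
  · rintro _ (rfl | rfl)
    exacts [⟨_, Or.inl rfl⟩, ⟨_, Or.inr rfl⟩]

theorem chAeval_surjective : Function.Surjective (MvPolynomial.aeval (R := ℤ)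
    ![chTrace (FreeMonoid Unit) (FreeMonoid.of ()),
      chDet (FreeMonoid Unit) (FreeMonoid.of ())]) := by
  rintro ⟨z, hz⟩
  have hz' := hz
  rw [chRing_freeMonoid, ← Matrix.range_cons_cons_empty _ _ ![],
    Algebra.adjoin_range_eq_range_aeval] at hz'
  obtain ⟨p, hp⟩ := hz'
  refine ⟨p, Subtype.ext (Eq.trans ?_ hp)⟩
  refine (MvPolynomial.comp_aeval_apply _ (chRing (FreeMonoid Unit)).val p).trans ?_
  refine congrArg (fun v => MvPolynomial.aeval v p) (funext fun i => ?_)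
  fin_cases i <;> rfl

/-- The representation of the free monoid of rank one that sends the generator to `A`. -/
def freeRep {R : Type*} [CommRing R] (A : Matrix (Fin 2) (Fin 2) R) :
    FreeMonoid Unit →* Matrix (Fin 2) (Fin 2) R :=
  FreeMonoid.lift fun _ => A

theorem freeRep_of {R : Type*} [CommRing R] (A : Matrix (Fin 2) (Fin 2) R) :
    freeRep A (FreeMonoid.of ()) = A := by
  simp [freeRep]

theorem repPoint_symm_univRep {R : Type} [CommRing R] (A : Matrix (Fin 2) (Fin 2) R) :
    ((repPoint (FreeMonoid Unit) R).symm (freeRep A)).mapMatrix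
      (univRep (FreeMonoid Unit) (FreeMonoid.of ())) = A := by
  have h := (repPoint (FreeMonoid Unit) R).apply_symm_apply (freeRep A)
  exact (DFunLike.congr_fun h (FreeMonoid.of ())).trans (freeRep_of A)

/-- The companion matrix over `R`, as a homomorphism from the coordinate ring, takes the trace and
the determinant of the generic matrix to any prescribed values. -/
theorem repPoint_symm_companion {R : Type} [CommRing R] (t d : R) :
    (repPoint (FreeMonoid Unit) R).symm (freeRep (MatTwo.companion t d))
        (chTrace (FreeMonoid Unit) (FreeMonoid.of ())) = t ∧
      (repPoint (FreeMonoid Unit) R).symm (freeRep (MatTwo.companion t d))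
        (chDet (FreeMonoid Unit) (FreeMonoid.of ())) = d := by
  set f := (repPoint (FreeMonoid Unit) R).symm (freeRep (MatTwo.companion t d))
  have h := repPoint_symm_univRep (MatTwo.companion t d)
  constructor
  · change f (univRep (FreeMonoid Unit) (FreeMonoid.of ())).trace = t
    rw [AddMonoidHom.map_trace f]
    exact (congrArg Matrix.trace h).trans (MatTwo.trace_companion t d)
  · change f (univRep (FreeMonoid Unit) (FreeMonoid.of ())).det = d
    rw [RingHom.map_det, h, MatTwo.det_companion]

theorem chAeval_injective : Function.Injective (MvPolynomial.aeval (R := ℤ)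
    ![chTrace (FreeMonoid Unit) (FreeMonoid.of ()),
      chDet (FreeMonoid Unit) (FreeMonoid.of ())]) := by
  let f := (repPoint (FreeMonoid Unit) (MvPolynomial (Fin 2) ℤ)).symm
    (freeRep (MatTwo.companion (MvPolynomial.X 0) (MvPolynomial.X 1)))
  let g := (f.comp (chRing (FreeMonoid Unit)).val.toRingHom).comp (MvPolynomial.aeval (R := ℤ)
    ![chTrace (FreeMonoid Unit) (FreeMonoid.of ()),
      chDet (FreeMonoid Unit) (FreeMonoid.of ())]).toRingHom
  have hg : g = RingHom.id _ := by
    refine MvPolynomial.ringHom_ext (fun n => by simp [g]) fun i => ?_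
    obtain ⟨h0, h1⟩ := repPoint_symm_companion (MvPolynomial.X 0 : MvPolynomial (Fin 2) ℤ)
      (MvPolynomial.X 1)
    fin_cases i
    · simpa [g, f] using h0
    · simpa [g, f] using h1
  exact Function.LeftInverse.injective (g := f.comp (chRing (FreeMonoid Unit)).val.toRingHom)
    fun p => DFunLike.congr_fun hg p

theorem chRing_ringHom_ext {R : Type*} [CommRing R] {f g : chRing (FreeMonoid Unit) →+* R}
    (ht : f (chTrace _ (FreeMonoid.of ())) = g (chTrace _ (FreeMonoid.of ())))
    (hd : f (chDet _ (FreeMonoid.of ())) = g (chDet _ (FreeMonoid.of ()))) : f = g := by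
  refine (RingHom.cancel_right (f := (MvPolynomial.aeval (R := ℤ)
    ![chTrace (FreeMonoid Unit) (FreeMonoid.of ()),
      chDet (FreeMonoid Unit) (FreeMonoid.of ())]).toRingHom) chAeval_surjective).mp ?_
  refine MvPolynomial.ringHom_ext (fun n => by simp) fun i => ?_
  fin_cases i
  · simpa using ht
  · simpa using hd

/-! ### The locus of non-scalar matrices -/

/-- The open set of points of a scheme where a matrix of functions is not a scalar matrix. -/
def nonScalar {T : Scheme.{0}} {W : T.Opens} (A : Matrix (Fin 2) (Fin 2) Γ(T, W)) : T.Opens :=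
  T.basicOpen (A 0 1) ⊔ T.basicOpen (A 1 0) ⊔ T.basicOpen (A 0 0 - A 1 1)

theorem preimage_nonScalar {T T' : Scheme.{0}} (f : T' ⟶ T)
    (A : Matrix (Fin 2) (Fin 2) Γ(T, ⊤)) :
    f ⁻¹ᵁ nonScalar A = nonScalar (f.appTop.hom.mapMatrix A) := by
  simp only [nonScalar, Scheme.Hom.preimage_sup, Scheme.preimage_basicOpen_top]
  simp

theorem notMem_nonScalar_iff {T : Scheme.{0}} {W : T.Opens}
    (A : Matrix (Fin 2) (Fin 2) Γ(T, W)) {t : T} (ht : t ∈ W) :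
    t ∉ nonScalar A ↔ ∃ c : T.residueField t, (T.evaluation W t ht).hom.mapMatrix A = c • 1 := by
  simp only [nonScalar, TopologicalSpace.Opens.mem_sup, not_or,
    ← Scheme.evaluation_eq_zero_iff_notMem_basicOpen T t ht]
  constructor
  · rintro ⟨⟨h1, h2⟩, h3⟩
    rw [map_sub, sub_eq_zero] at h3
    refine ⟨T.evaluation W t ht (A 0 0), ?_⟩
    ext i j
    fin_cases i <;> fin_cases j <;> simp [h1, h2, h3]
  · rintro ⟨c, h⟩
    have h' (i j : Fin 2) := congrFun (congrFun h i) j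
    have h00 := h' 0 0
    have h11 := h' 1 1
    simp at h00 h11
    exact ⟨⟨by simpa using h' 0 1, by simpa using h' 1 0⟩, by rw [map_sub, h00, h11, sub_self]⟩

/-- Automorphisms of the matrix algebra specialize to the residue fields and fix scalar matrices. -/
theorem nonScalar_le_algEquiv {T : Scheme.{0}} (A : Matrix (Fin 2) (Fin 2) Γ(T, ⊤))
    (φ : Matrix (Fin 2) (Fin 2) Γ(T, ⊤) ≃ₐ[Γ(T, ⊤)] Matrix (Fin 2) (Fin 2) Γ(T, ⊤)) :
    nonScalar (φ A) ≤ nonScalar A := by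
  intro t
  contrapose
  rw [notMem_nonScalar_iff _ (W := ⊤) trivial, notMem_nonScalar_iff _ (W := ⊤) trivial]
  rintro ⟨c, h⟩
  refine ⟨c, ?_⟩
  rw [← MatTwo.autMap_mapMatrix, h, map_smul, map_one]

theorem nonScalar_algEquiv {T : Scheme.{0}} (A : Matrix (Fin 2) (Fin 2) Γ(T, ⊤))
    (φ : Matrix (Fin 2) (Fin 2) Γ(T, ⊤) ≃ₐ[Γ(T, ⊤)] Matrix (Fin 2) (Fin 2) Γ(T, ⊤)) :
    nonScalar (φ A) = nonScalar A :=
  le_antisymm (nonScalar_le_algEquiv A φ) (by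
    simpa using nonScalar_le_algEquiv (φ A) φ.symm)

/-- A non-scalar matrix has `(1, 0)`, `(0, 1)` or `(1, 1)` as a cyclic vector. -/
theorem exists_mem_basicOpen_det_krylov {T : Scheme.{0}} {A : Matrix (Fin 2) (Fin 2) Γ(T, ⊤)}
    {t : T} (ht : t ∈ nonScalar A) :
    ∃ x y : Γ(T, ⊤), t ∈ T.basicOpen (MatTwo.krylov A x y).det := by
  by_contra! h
  have h' (x y : Γ(T, ⊤)) := h x y
  simp only [← Scheme.evaluation_eq_zero_iff_notMem_basicOpen T (U := ⊤) t trivial,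
    MatTwo.det_krylov] at h'
  have h1 := h' 1 0
  have h2 := h' 0 1
  have h3 := h' 1 1
  simp only [nonScalar, TopologicalSpace.Opens.mem_sup,
    ← Scheme.evaluation_ne_zero_iff_mem_basicOpen T (U := ⊤) t trivial] at ht
  simp at h1 h2 h3
  simp [h1, h2] at h3 ht
  grind

theorem isUnit_appTop_of_le_basicOpen {T : Scheme.{0}} {f : Γ(T, ⊤)} {V : T.Opens}
    (hV : V ≤ T.basicOpen f) : IsUnit (V.ι.appTop f) := by
  refine V.toScheme.toRingedSpace.isUnit_of_isUnit_germ ⊤ _ fun x hx => ?_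
  have h : x ∈ V.ι ⁻¹ᵁ T.basicOpen f := hV x.2
  rw [Scheme.preimage_basicOpen_top] at h
  exact (V.toScheme.mem_basicOpen_top _ x).mp h

/-! ### Molds of rank two generated by one matrix -/

theorem RepOn.restrict_of {X : Scheme.{0}} (ρ : RepOn (FreeMonoid Unit) X) (U : X.Opens) :
    ρ.restrict U (FreeMonoid.of ()) =
      (X.presheaf.map (homOfLE le_top : U ⟶ ⊤).op).hom.mapMatrix (ρ (FreeMonoid.of ())) := rfl

theorem nonScalar_restrict {X : Scheme.{0}} (A : Matrix (Fin 2) (Fin 2) Γ(X, ⊤)) (U : X.Opens) :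
    nonScalar ((X.presheaf.map (homOfLE le_top : U ⟶ ⊤).op).hom.mapMatrix A) =
      U ⊓ nonScalar A := by
  simp only [nonScalar, inf_sup_left, ← Scheme.basicOpen_res X _ (homOfLE le_top : U ⟶ ⊤).op]
  simp

/-- Where the image of a representation generates a mold of rank `2`, the identity and the image `A`
of the generator are part of a basis locally; hence `A` is not scalar at any point. -/
theorem RepOn.GeneratesMold.le_nonScalar {X : Scheme.{0}} {ρ : RepOn (FreeMonoid Unit) X}
    {W : X.Opens} (h : ρ.GeneratesMold 2 W) : W ≤ nonScalar (ρ (FreeMonoid.of ())) := by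
  intro x hx
  obtain ⟨U, hxU, hUW, hU, hq, hf, hr⟩ := h x hx
  set A := ρ.restrict U (FreeMonoid.of ()) with hA
  suffices hxA : x ∈ nonScalar A by
    rw [hA, RepOn.restrict_of, nonScalar_restrict] at hxA
    exact hxA.2
  by_contra hxA
  obtain ⟨c, hc⟩ := (notMem_nonScalar_iff A hxU).mp hxA
  have hN : Subalgebra.toSubmodule (ρ.image U) = Submodule.span _ {1, A} :=
    toSubmodule_adjoin_range (ρ.restrict U)
  have : Nonempty U := ⟨⟨x, hxU⟩⟩
  have : Nontrivial Γ(X, U) := X.component_nontrivial U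
  have hfin : Module.Finite Γ(X, U) (ρ.image U) := Module.finite_of_finrank_pos (by omega)
  let b := Module.finBasisOfFinrankEq Γ(X, U) (ρ.image U) hr
  let e : (Fin 2 → Γ(X, U)) ≃ₗ[Γ(X, U)] Submodule.span Γ(X, U) {1, A} :=
    b.equivFun.symm.trans ((Subalgebra.toSubmoduleEquiv _).symm.trans (LinearEquiv.ofEq _ _ hN))
  rw [hN] at hq
  obtain ⟨μ, h1, h2⟩ := MatTwo.exists_linearForm hq e
  -- At `x` the linear form `μ` vanishes on scalar matrices, and `A` is scalar there.
  have key (B : Matrix (Fin 2) (Fin 2) Γ(X, U)) : X.evaluation U x hxU (μ B) =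
      ∑ i, ∑ j, (X.evaluation U x hxU).hom.mapMatrix B i j *
        X.evaluation U x hxU (μ (Matrix.single i j 1)) := by
    conv_lhs => rw [Matrix.matrix_eq_sum_single B]
    simp only [map_sum]
    refine Finset.sum_congr rfl fun i _ => Finset.sum_congr rfl fun j _ => ?_
    have : Matrix.single i j (B i j) = B i j • Matrix.single i j (1 : Γ(X, U)) := by simp
    rw [this, map_smul, smul_eq_mul, map_mul]
    rfl
  have k1 := key 1
  have k2 := key A
  rw [h1, map_zero, map_one] at k1
  rw [h2, hc, map_one] at k2
  have : (1 : X.residueField x) = c * 0 := by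
    rw [k1, k2, Finset.mul_sum]
    simp only [Finset.mul_sum, Matrix.smul_apply, smul_eq_mul, mul_assoc]
  simp at this

theorem RepOn.generatesMold_basicOpen {X : Scheme.{0}} [IsAffine X]
    (ρ : RepOn (FreeMonoid Unit) X) (x y : Γ(X, ⊤)) :
    ρ.GeneratesMold 2 (X.basicOpen (MatTwo.krylov (ρ (FreeMonoid.of ())) x y).det) := by
  set U := X.basicOpen (MatTwo.krylov (ρ (FreeMonoid.of ())) x y).det with hU
  intro t ht
  refine ⟨U, ht, le_rfl, (isAffineOpen_top X).basicOpen _, ?_⟩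
  have hunit : IsUnit (MatTwo.krylov (ρ.restrict U (FreeMonoid.of ()))
      (X.presheaf.map (homOfLE le_top : U ⟶ ⊤).op x)
      (X.presheaf.map (homOfLE le_top : U ⟶ ⊤).op y)).det := by
    have h := X.toRingedSpace.isUnit_res_basicOpen
      (MatTwo.krylov (ρ (FreeMonoid.of ())) x y).det
    have h2 := MatTwo.map_krylov (X.presheaf.map (homOfLE le_top : U ⟶ ⊤).op).hom
      (ρ (FreeMonoid.of ())) x y
    rw [RepOn.restrict_of, ← h2, ← RingHom.map_det]
    exact h
  have : Nonempty U := ⟨⟨t, ht⟩⟩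
  have : Nontrivial Γ(X, U) := X.component_nontrivial U
  obtain ⟨⟨e⟩, ⟨e'⟩⟩ := MatTwo.free_span_one_self hunit
  have hN : Subalgebra.toSubmodule (ρ.image U) =
    Submodule.span _ {1, ρ.restrict U (FreeMonoid.of ())} :=
    toSubmodule_adjoin_range (ρ.restrict U)
  rw [← hN] at e e'
  let e2 := e.trans (Subalgebra.toSubmoduleEquiv _)
  exact ⟨Module.Free.of_equiv e'.symm, Module.Free.of_equiv e2,
    by rw [← e2.finrank_eq, Module.finrank_fin_fun]⟩

theorem rkTwoLocus_eq_nonScalar : rkTwoLocus (FreeMonoid Unit) =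
    nonScalar (repRkLeTaut (FreeMonoid Unit) (FreeMonoid.of ())) := by
  refine le_antisymm (sSup_le fun W hW => RepOn.GeneratesMold.le_nonScalar hW) fun t ht => ?_
  obtain ⟨x, y, h⟩ := exists_mem_basicOpen_det_krylov ht
  exact TopologicalSpace.Opens.mem_sSup.mpr ⟨_, RepOn.generatesMold_basicOpen _ x y, h⟩

/-! ### Points of the scheme of representations of rank two -/

/-- The closed condition `rk ≤ 2` holds everywhere, by the Cayley–Hamilton theorem. -/
theorem isIso_repRkLeι : IsIso (repRkLeι (FreeMonoid Unit)) := by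
  have hb : Function.Bijective (Ideal.Quotient.mk (minorIdeal (FreeMonoid Unit))) :=
    ⟨(injective_iff_map_eq_zero _).mpr fun a ha => by
      rwa [Ideal.Quotient.eq_zero_iff_mem, minorIdeal_freeMonoid, Ideal.mem_bot] at ha,
      Ideal.Quotient.mk_surjective⟩
  let F : CommRingCat.of (RepRing (FreeMonoid Unit)) ⟶
      CommRingCat.of (RepRing (FreeMonoid Unit) ⧸ minorIdeal (FreeMonoid Unit)) :=
    CommRingCat.ofHom (Ideal.Quotient.mk (minorIdeal (FreeMonoid Unit)))
  have : IsIso F := (ConcreteCategory.isIso_iff_bijective F).mpr hb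
  exact inferInstanceAs (IsIso (Spec.map F))

instance mono_repRkTwoι : Mono (repRkTwoι (FreeMonoid Unit)) := by
  have := isIso_repRkLeι
  unfold repRkTwoι RepRkTwo
  infer_instance

/-- The matrix of functions on `T` that is the image of the generator under the representation
given by a `T`-valued point. -/
def rkTwoMat {T : Scheme.{0}} (f : T ⟶ RepRkTwo (FreeMonoid Unit)) :
    Matrix (Fin 2) (Fin 2) Γ(T, ⊤) :=
  repVarPoint (FreeMonoid Unit) T (f ≫ repRkTwoι _) (FreeMonoid.of ())

theorem rkTwoMat_injective {T : Scheme.{0}} :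
    Function.Injective (rkTwoMat : (T ⟶ RepRkTwo (FreeMonoid Unit)) → _) := by
  intro f g h
  rw [← cancel_mono (repRkTwoι (FreeMonoid Unit))]
  apply (repVarPoint (FreeMonoid Unit) T).injective
  exact FreeMonoid.hom_eq fun _ => h

theorem rkTwoMat_comp {T T' : Scheme.{0}} (h : T' ⟶ T) (f : T ⟶ RepRkTwo (FreeMonoid Unit)) :
    rkTwoMat (h ≫ f) = h.appTop.hom.mapMatrix (rkTwoMat f) := by
  rw [rkTwoMat, Category.assoc, repVarPoint_comp]
  rfl

theorem nonScalar_rkTwoMat {T : Scheme.{0}} (f : T ⟶ RepRkTwo (FreeMonoid Unit)) :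
    nonScalar (rkTwoMat f) = ⊤ := by
  have h : rkTwoMat f = (f ≫ (rkTwoLocus (FreeMonoid Unit)).ι).appTop.hom.mapMatrix
      (repRkLeTaut (FreeMonoid Unit) (FreeMonoid.of ())) :=
    DFunLike.congr_fun (repVarPoint_comp (FreeMonoid Unit)
      (f ≫ (rkTwoLocus (FreeMonoid Unit)).ι) (repRkLeι _)) (FreeMonoid.of ())
  rw [h, ← preimage_nonScalar, ← rkTwoLocus_eq_nonScalar, eq_top_iff]
  exact fun x _ => (f x).2

/-- `T`-valued points of `Rep₂(Υ)_{rk 2}` are matrices of functions on `T` that are nowhere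
scalar. -/
theorem exists_rkTwoMat_eq {T : Scheme.{0}} (A : Matrix (Fin 2) (Fin 2) Γ(T, ⊤))
    (hA : nonScalar A = ⊤) : ∃ f : T ⟶ RepRkTwo (FreeMonoid Unit), rkTwoMat f = A := by
  have := isIso_repRkLeι
  let k : T ⟶ RepRkLe (FreeMonoid Unit) :=
    (repVarPoint (FreeMonoid Unit) T).symm (freeRep A) ≫ inv (repRkLeι _)
  have hk : k ≫ repRkLeι _ = (repVarPoint (FreeMonoid Unit) T).symm (freeRep A) := by simp [k]
  have hA' : A = k.appTop.hom.mapMatrix (repRkLeTaut (FreeMonoid Unit) (FreeMonoid.of ())) := by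
    have h := repVarPoint_comp (FreeMonoid Unit) k (repRkLeι _)
    rw [hk, Equiv.apply_symm_apply] at h
    exact (freeRep_of A).symm.trans (DFunLike.congr_fun h _)
  have hr : Set.range k ⊆ Set.range (rkTwoLocus (FreeMonoid Unit)).ι := by
    rw [Scheme.Opens.range_ι, rkTwoLocus_eq_nonScalar]
    rintro _ ⟨t, rfl⟩
    have ht : t ∈ nonScalar A := by rw [hA]; trivial
    rw [hA', ← preimage_nonScalar] at ht
    exact ht
  let f : T ⟶ (rkTwoLocus (FreeMonoid Unit)).toScheme := IsOpenImmersion.lift _ k hr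
  have hf : f ≫ (rkTwoLocus (FreeMonoid Unit)).ι ≫ repRkLeι _ =
      (repVarPoint (FreeMonoid Unit) T).symm (freeRep A) := by
    rw [IsOpenImmersion.lift_fac_assoc, hk]
  refine ⟨f, ?_⟩
  refine (DFunLike.congr_fun (congrArg (repVarPoint (FreeMonoid Unit) T) hf) _).trans ?_
  rw [Equiv.apply_symm_apply, freeRep_of]

/-! ### The quotient morphism on points -/

theorem specPoint_comp_specMap {R S : Type} [CommRing R] [CommRing S] (φ : R →+* S)
    {T : Scheme.{0}} (f : T ⟶ Spec (CommRingCat.of S)) :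
    specPoint R T (f ≫ Spec.map (CommRingCat.ofHom φ)) = (specPoint S T f).comp φ := by
  rw [specPoint_comp]
  have h := Scheme.ΓSpecIso_inv_naturality (CommRingCat.ofHom φ)
  exact congrArg (fun k => f.appTop.hom.comp k.hom) h.symm

theorem specPoint_comp_rkTwoToCh {T : Scheme.{0}} (f : T ⟶ RepRkTwo (FreeMonoid Unit)) :
    specPoint (chRing (FreeMonoid Unit)) T (f ≫ rkTwoToCh _) =
      (specPoint (RepRing (FreeMonoid Unit)) T (f ≫ repRkTwoι _)).comp
        (chRing (FreeMonoid Unit)).val.toRingHom := by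
  rw [rkTwoToCh, ← Category.assoc]
  exact specPoint_comp_specMap _ _

theorem rkTwoMat_eq {T : Scheme.{0}} (f : T ⟶ RepRkTwo (FreeMonoid Unit)) :
    rkTwoMat f = (specPoint (RepRing (FreeMonoid Unit)) T (f ≫ repRkTwoι _)).mapMatrix
      (univRep (FreeMonoid Unit) (FreeMonoid.of ())) := rfl

theorem specPoint_chTrace {T : Scheme.{0}} (f : T ⟶ RepRkTwo (FreeMonoid Unit)) :
    specPoint (chRing (FreeMonoid Unit)) T (f ≫ rkTwoToCh _) (chTrace _ (FreeMonoid.of ())) =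
      (rkTwoMat f).trace := by
  rw [specPoint_comp_rkTwoToCh, rkTwoMat_eq]
  generalize specPoint (RepRing (FreeMonoid Unit)) T (f ≫ repRkTwoι _) = φ
  exact AddMonoidHom.map_trace φ (univRep (FreeMonoid Unit) (FreeMonoid.of ()))

theorem specPoint_chDet {T : Scheme.{0}} (f : T ⟶ RepRkTwo (FreeMonoid Unit)) :
    specPoint (chRing (FreeMonoid Unit)) T (f ≫ rkTwoToCh _) (chDet _ (FreeMonoid.of ())) =
      (rkTwoMat f).det := by
  rw [specPoint_comp_rkTwoToCh, rkTwoMat_eq]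
  generalize specPoint (RepRing (FreeMonoid Unit)) T (f ≫ repRkTwoι _) = φ
  exact RingHom.map_det φ (univRep (FreeMonoid Unit) (FreeMonoid.of ()))

theorem comp_rkTwoToCh_eq_iff {T : Scheme.{0}} (f g : T ⟶ RepRkTwo (FreeMonoid Unit)) :
    f ≫ rkTwoToCh _ = g ≫ rkTwoToCh _ ↔
      (rkTwoMat f).trace = (rkTwoMat g).trace ∧ (rkTwoMat f).det = (rkTwoMat g).det := by
  rw [← specPoint_chTrace, ← specPoint_chTrace, ← specPoint_chDet, ← specPoint_chDet]
  constructor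
  · intro h
    rw [h]
    exact ⟨rfl, rfl⟩
  · rintro ⟨h1, h2⟩
    exact (specPoint (chRing (FreeMonoid Unit)) T).injective (chRing_ringHom_ext h1 h2)

theorem nonScalar_companion {T : Scheme.{0}} (t d : Γ(T, ⊤)) :
    nonScalar (MatTwo.companion t d) = ⊤ := by
  have h : T.basicOpen (MatTwo.companion t d 1 0) = ⊤ := T.basicOpen_one
  rw [nonScalar, h, sup_top_eq, top_sup_eq]

/-- The companion matrix defines a section of `π`. -/
theorem exists_section_rkTwoToCh :
    ∃ s : ChVar (FreeMonoid Unit) ⟶ RepRkTwo (FreeMonoid Unit), s ≫ rkTwoToCh _ = 𝟙 _ := by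
  let u := specPoint (chRing (FreeMonoid Unit)) (ChVar (FreeMonoid Unit)) (𝟙 _)
  obtain ⟨s, hs⟩ := exists_rkTwoMat_eq _ (nonScalar_companion
    (u (chTrace _ (FreeMonoid.of ()))) (u (chDet _ (FreeMonoid.of ()))))
  refine ⟨s, (specPoint (chRing (FreeMonoid Unit)) _).injective (chRing_ringHom_ext ?_ ?_)⟩
  · rw [specPoint_chTrace, hs, MatTwo.trace_companion]
  · rw [specPoint_chDet, hs, MatTwo.det_companion]

/-! ### The action on the scheme of representations of rank two -/

theorem repVarPoint_act_of {T : Scheme.{0}} (g : T ⟶ PGLTwo)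
    (f : T ⟶ RepRkTwo (FreeMonoid Unit)) :
    repVarPoint (FreeMonoid Unit) T (lift g (f ≫ repRkTwoι _) ≫ repAct _) (FreeMonoid.of ()) =
      PGLTwo.aut g (rkTwoMat f) :=
  repVarPoint_act _ _ _ _

/-- The action of `PGL₂` by conjugation restricts to `Rep₂(Υ)_{rk 2}`, because a conjugate of a
nowhere scalar matrix is nowhere scalar. -/
theorem exists_rkTwoAct :
    ∃ a : PGLTwo ⊗ RepRkTwo (FreeMonoid Unit) ⟶ RepRkTwo (FreeMonoid Unit),
      a ≫ repRkTwoι _ = PGLTwo ◁ repRkTwoι _ ≫ repAct _ := by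
  obtain ⟨a, ha⟩ := exists_rkTwoMat_eq
    (PGLTwo.aut (fst PGLTwo (RepRkTwo (FreeMonoid Unit)))
      (rkTwoMat (snd PGLTwo (RepRkTwo (FreeMonoid Unit)))))
    (by rw [nonScalar_algEquiv, nonScalar_rkTwoMat])
  refine ⟨a, (repVarPoint (FreeMonoid Unit) _).injective (FreeMonoid.hom_eq fun _ => ?_)⟩
  have h : PGLTwo ◁ repRkTwoι (FreeMonoid Unit) = lift (fst _ _) (snd _ _ ≫ repRkTwoι _) := by
    ext <;> simp
  rw [h]
  exact ha.trans (repVarPoint_act_of _ _).symm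

/-- If `i : X ⟶ Z` is a monomorphism and `a : G ⊗ X ⟶ X` is compatible along `i` with an action of
`G` on `Z`, then `a` is an action of `G` on `X`. -/
@[reducible]
def modObjOfMono {C : Type*} [Category C] [CartesianMonoidalCategory C] {G X Z : C} [MonObj G]
    [m : ModObj G Z] (i : X ⟶ Z) [Mono i] (a : G ⊗ X ⟶ X)
    (h : a ≫ i = G ◁ i ≫ (m.smul : G ⊗ Z ⟶ Z)) : ModObj G X where
  smul := a
  one_smul := by
    have h1 : MonObj.one ▷ Z ≫ (m.smul : G ⊗ Z ⟶ Z) = (λ_ Z).hom := m.one_smul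
    change MonObj.one ▷ X ≫ a = (λ_ X).hom
    rw [← cancel_mono i, Category.assoc, h, ← whisker_exchange_assoc, h1, leftUnitor_naturality]
  mul_smul := by
    have h1 : MonObj.mul ▷ Z ≫ (m.smul : G ⊗ Z ⟶ Z) =
      (α_ G G Z).hom ≫ G ◁ (m.smul : G ⊗ Z ⟶ Z) ≫ (m.smul : G ⊗ Z ⟶ Z) := m.mul_smul
    change MonObj.mul ▷ X ≫ a = (α_ G G X).hom ≫ G ◁ a ≫ a
    rw [← cancel_mono i]
    simp only [Category.assoc, h]
    rw [← whisker_exchange_assoc, h1, ← whiskerLeft_comp_assoc, h]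
    simp

theorem PGLTwo.exists_aut_eq {T : Scheme.{0}}
    (φ : Matrix (Fin 2) (Fin 2) Γ(T, ⊤) ≃ₐ[Γ(T, ⊤)] Matrix (Fin 2) (Fin 2) Γ(T, ⊤)) :
    ∃ g : T ⟶ PGLTwo, PGLTwo.aut g = φ :=
  pglRepresentable.homEquiv.surjective φ

theorem rkTwoMat_lift_comp {a : PGLTwo ⊗ RepRkTwo (FreeMonoid Unit) ⟶ RepRkTwo (FreeMonoid Unit)}
    (ha : a ≫ repRkTwoι _ = PGLTwo ◁ repRkTwoι _ ≫ repAct _) {T : Scheme.{0}} (g : T ⟶ PGLTwo)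
    (f : T ⟶ RepRkTwo (FreeMonoid Unit)) :
    rkTwoMat (lift g f ≫ a) = PGLTwo.aut g (rkTwoMat f) := by
  rw [← repVarPoint_act_of, rkTwoMat, Category.assoc, ha, lift_whiskerLeft_assoc]

/-- The quotient morphism is invariant. -/
theorem act_comp_rkTwoToCh
    {a : PGLTwo ⊗ RepRkTwo (FreeMonoid Unit) ⟶ RepRkTwo (FreeMonoid Unit)}
    (ha : a ≫ repRkTwoι _ = PGLTwo ◁ repRkTwoι _ ≫ repAct _) :
    a ≫ rkTwoToCh _ = snd _ _ ≫ rkTwoToCh _ := by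
  have h : a = lift (fst _ _) (snd _ _) ≫ a := by simp
  rw [comp_rkTwoToCh_eq_iff, h, rkTwoMat_lift_comp ha]
  exact ⟨MatTwo.trace_algEquiv _ _, MatTwo.det_algEquiv _ _⟩

/-- Locally on `T`, two `T`-valued points with the same trace and determinant have cyclic vectors,
so both are conjugate to the same companion matrix. -/
theorem isLocallyTransitive_act
    {a : PGLTwo ⊗ RepRkTwo (FreeMonoid Unit) ⟶ RepRkTwo (FreeMonoid Unit)}
    (ha : a ≫ repRkTwoι _ = PGLTwo ◁ repRkTwoι _ ≫ repAct _) :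
    IsLocallyTransitive a (rkTwoToCh (FreeMonoid Unit)) := by
  intro T f g hfg t
  have hmem (k : T ⟶ RepRkTwo (FreeMonoid Unit)) : t ∈ nonScalar (rkTwoMat k) := by
    rw [nonScalar_rkTwoMat]; trivial
  obtain ⟨x, y, hxy⟩ := exists_mem_basicOpen_det_krylov (hmem f)
  obtain ⟨z, w, hzw⟩ := exists_mem_basicOpen_det_krylov (hmem g)
  let V : T.Opens := T.basicOpen (MatTwo.krylov (rkTwoMat f) x y).det ⊓
    T.basicOpen (MatTwo.krylov (rkTwoMat g) z w).det
  have hf := isUnit_appTop_of_le_basicOpen (V := V) inf_le_left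
  have hg := isUnit_appTop_of_le_basicOpen (V := V) inf_le_right
  have hV : V.ι ≫ f ≫ rkTwoToCh _ = V.ι ≫ g ≫ rkTwoToCh _ := by rw [hfg]
  rw [← Category.assoc, ← Category.assoc, comp_rkTwoToCh_eq_iff] at hV
  have hdet (A : Matrix (Fin 2) (Fin 2) Γ(T, ⊤)) (x y : Γ(T, ⊤)) :
      V.ι.appTop (MatTwo.krylov A x y).det =
        (MatTwo.krylov (V.ι.appTop.hom.mapMatrix A) (V.ι.appTop x) (V.ι.appTop y)).det := by
    rw [← MatTwo.map_krylov V.ι.appTop.hom, ← RingHom.map_det]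
  rw [hdet, ← rkTwoMat_comp] at hf hg
  obtain ⟨φ, hφ⟩ := MatTwo.exists_conj_eq hf hg hV.1 hV.2
  obtain ⟨γ, rfl⟩ := PGLTwo.exists_aut_eq φ
  exact ⟨V, ⟨hxy, hzw⟩, γ, rkTwoMat_injective ((rkTwoMat_lift_comp ha γ (V.ι ≫ g)).trans hφ)⟩

end

/-- For the free monoid `Υ` of rank `1`, the ring of `Ch₂(Υ)` is the polynomial ring on the trace
and the determinant of the generic matrix, and `π : Rep₂(Υ)_{rk 2} → Ch₂(Υ)` is a universal
geometric quotient for the action of `PGL₂` on `Rep₂(Υ)_{rk 2}` induced by that on `Rep₂(Υ)`. -/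
theorem mainTheorem8 :
    Function.Bijective (MvPolynomial.aeval (R := ℤ)
      ![chTrace (FreeMonoid Unit) (FreeMonoid.of ()), chDet (FreeMonoid Unit) (FreeMonoid.of ())]) ∧
    ∃ act : ModObj PGLTwo (RepRkTwo (FreeMonoid Unit)),
      (act.smul : PGLTwo ⊗ RepRkTwo (FreeMonoid Unit) ⟶ RepRkTwo (FreeMonoid Unit)) ≫
          repRkTwoι (FreeMonoid Unit) =
        PGLTwo ◁ repRkTwoι (FreeMonoid Unit) ≫ repAct (FreeMonoid Unit) ∧
      IsUniversalGeometricQuotient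
        (act.smul : PGLTwo ⊗ RepRkTwo (FreeMonoid Unit) ⟶ RepRkTwo (FreeMonoid Unit))
        (rkTwoToCh (FreeMonoid Unit)) := by
  refine ⟨⟨chAeval_injective, chAeval_surjective⟩, ?_⟩
  obtain ⟨a, ha⟩ := exists_rkTwoAct
  obtain ⟨s, hs⟩ := exists_section_rkTwoToCh
  exact ⟨modObjOfMono (repRkTwoι (FreeMonoid Unit)) a ha, ha,
    (isLocallyTransitive_act ha).isUniversalGeometricQuotient (act_comp_rkTwoToCh ha) hs⟩
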